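/- **Corollary (high dimensions, sliding window).** There are one sliding-window algorithm (a fixed program) and a constant $C$ such that the following holds for all integers $d\ge 1$, $m\ge 2$, $w\ge 2$ and all reals $\alpha>0$ and $\beta$ with $\beta>d^{1.5}\alpha$ and $\beta>2\alpha$ (the second condition only matters for $d=1$). Let $p_1,\dots,p_m\in\mathbb R^d$ be a stream whose point set is $(\alpha,\beta)$-sparse, i.e. any two points are at Euclidean distance at most $\alpha$ or more than $\beta$, and let the points arrive at integer time steps $\tau_1<\dots<\tau_m$. Let $W_t$ be the set of points that arrive in the last $w$ time steps $t-w+1,\dots,t$ (for $\tau_i=i$ this is the sequence-based sliding window, for general $\tau$ the time-based one). A random point $u\in W_t$ is a *robust $\ell_0$-sample* of $W_t$ if $\Pr[u\in G]=1/n$ for each of the $n$ groups $G$ of the natural partition of $W_t$ (the partition in which points of one group are at distance at most $\alpha$ and points of different groups are at distance more than $2\alpha$). The algorithm knows $d,m,w,\alpha$. It uses at most $C\,d\log w\log m$ words of memory, and spends at most $C\,d\log w\log m$ time on each arriving item, and on each query. With probability at least $1-1/m$, it outputs a robust $\ell_0$-sample of $W_t$ at every time step $t$ with $W_t\ne\emptyset$: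 there are random points $u_t$, each a robust $\ell_0$-sample of $W_t$, defined on one probability space with the algorithm's randomness, such that with probability at least $1-1/m$ the outputs of the algorithm equal $u_t$ at all these times simultaneously. The machine is a random access machine with real arithmetic, rounding, comparison and indirect addressing at unit cost, and with a fully random hash function into $[0,1]$ on finite lists of integers, where hashing a list of length $k$ costs $k+1$ steps. Between items, each word holds an integer of $O(\log(dwm))$ bits, the parameter $\alpha$, or a number copied from the stream (a coordinate or an arrival time). -/

import Mathlib

open MeasureTheory

/-! ### Datasets and robust sampling -/

/-- `S` is `(α, β)`-sparse: any two points are at distance at most `α` or more than `β`. -/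
def IsSparse {E : Type*} [PseudoMetricSpace E] (α β : ℝ) (S : Set E) : Prop :=
  ∀ u ∈ S, ∀ v ∈ S, dist u v ≤ α ∨ β < dist u v

open Classical in
/-- The natural partition of a finite dataset: intra-group distances are at most `α`, and
inter-group distances are more than `2 * α`. (There is at most one such partition.) -/
def IsNaturalPartition {E : Type*} [PseudoMetricSpace E] (α : ℝ) {W : Finset E}
    (P : Finpartition W) : Prop :=
  (∀ G ∈ P.parts, ∀ u ∈ G, ∀ v ∈ G, dist u v ≤ α) ∧
  (∀ G ∈ P.parts, ∀ G' ∈ P.parts, G ≠ G' → ∀ u ∈ G, ∀ v ∈ G', 2 * α < dist u v)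

open Classical in
/-- The random point `u` is a robust `ℓ₀`-sample of the (well-separated) dataset `W`: it is a point
of `W`, and it lies in each of the `n` groups of the natural partition with probability `1 / n`. -/
def IsRobustSample {E : Type*} [PseudoMetricSpace E] [MeasurableSpace E] {Ω : Type*}
    [MeasurableSpace Ω] (ℙ : Measure Ω) (α : ℝ) (W : Finset E) (u : Ω → E) : Prop :=
  Measurable u ∧ (∀ ω, u ω ∈ W) ∧
  ∃ P : Finpartition W, IsNaturalPartition α P ∧
    ∀ G ∈ P.parts, ℙ.real {ω | u ω ∈ G} = 1 / (P.parts.card : ℝ)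

/-! ### Streams and sliding windows

The `i`-th point of a stream of `m` points arrives at the time step `τ i`, where `τ` is strictly
increasing. Arbitrary `τ` is the time-based model; `τ i = i + 1` is the sequence-based one, in which
the window at time `t` consists of the last `w` points. -/

open Classical in
/-- The set of points received in the last `w` time steps `t - w + 1, …, t`. -/
noncomputable def window {E : Type*} {m : ℕ} (x : Fin m → E) (τ : Fin m → ℕ) (w t : ℕ) :
    Finset E :=
  (Finset.univ.filter fun i => τ i ≤ t ∧ t < τ i + w).image x

/-- The number of points that have arrived by time `t`. -/
def arrived {m : ℕ} (τ : Fin m → ℕ) (t : ℕ) : ℕ :=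
  (Finset.univ.filter fun i => τ i ≤ t).card

/-! ### A random access machine with a random hash function

The memory is an array of words, each of which holds a number. Programs are finite texts. An
arithmetic operation, a memory access, an access to the input or a test takes one time step; hashing
a list of `n` integers takes `n + 1` steps. -/

/-- The contents of the memory. -/
abbrev Mem := ℕ → ℝ

/-- A hash function with values in `[0, 1]`, defined on all finite lists of integers. -/
abbrev HashFun := List ℤ → unitInterval

/-- The law of a fully random hash function: values are independent and uniform on `[0, 1]`. -/
noncomputable def hashLaw : Measure HashFun :=
  Measure.infinitePi fun _ : List ℤ => (volume : Measure unitInterval)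

/-- Instructions; `a`, `b`, `c` are addresses, and `M` is the current memory. -/
inductive Instr where
  /-- `M[a] := q` -/
  | const (a : ℕ) (q : ℚ)
  /-- `M[a] := M[b] + M[c]` -/
  | add (a b c : ℕ)
  /-- `M[a] := M[b] - M[c]` -/
  | sub (a b c : ℕ)
  /-- `M[a] := M[b] * M[c]` -/
  | mul (a b c : ℕ)
  /-- `M[a] := M[b] / M[c]`, which is `0` if `M[c] = 0` -/
  | div (a b c : ℕ)
  /-- `M[a] := ⌊M[b]⌋` -/
  | floor (a b : ℕ)
  /-- `M[a] := M[M[b]]` -/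
  | load (a b : ℕ)
  /-- `M[M[a]] := M[b]` -/
  | store (a b : ℕ)
  /-- `M[a] :=` the input word number `M[b]` -/
  | input (a b : ℕ)
  /-- `M[a] :=` the hash value of the list of the integers `⌊M[s]⌋, …, ⌊M[s + n - 1]⌋`, where
  `s = M[b]` and `n = M[c]` -/
  | hash (a b c : ℕ)

namespace Instr

/-- The addresses that an instruction reads or writes. -/
def Touches (M : Mem) (k : ℕ) : Instr → Prop
  | const a _ => k = a
  | add a b c | sub a b c | mul a b c | div a b c => k = a ∨ k = b ∨ k = c
  | floor a b => k = a ∨ k = b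
  | load a b => k = a ∨ k = b ∨ k = ⌊M b⌋₊
  | store a b => k = a ∨ k = b ∨ k = ⌊M a⌋₊
  | input a b => k = a ∨ k = b
  | hash a b c => k = a ∨ k = b ∨ k = c ∨ (⌊M b⌋₊ ≤ k ∧ k < ⌊M b⌋₊ + ⌊M c⌋₊)

/-- The number of time steps that an instruction takes. -/
noncomputable def cost (M : Mem) : Instr → ℕ
  | hash _ _ c => ⌊M c⌋₊ + 1
  | _ => 1

/-- The effect of an instruction on the memory. -/
noncomputable def apply (h : HashFun) (inp : ℕ → ℝ) (M : Mem) : Instr → Mem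
  | const a q => Function.update M a (q : ℝ)
  | add a b c => Function.update M a (M b + M c)
  | sub a b c => Function.update M a (M b - M c)
  | mul a b c => Function.update M a (M b * M c)
  | div a b c => Function.update M a (M b / M c)
  | floor a b => Function.update M a (⌊M b⌋ : ℝ)
  | load a b => Function.update M a (M ⌊M b⌋₊)
  | store a b => Function.update M ⌊M a⌋₊ (M b)
  | input a b => Function.update M a (inp ⌊M b⌋₊)
  | hash a b c => Function.update M a
      (h ((List.range ⌊M c⌋₊).map fun k => ⌊M (⌊M b⌋₊ + k)⌋) : ℝ)

end Instr

/-- Programs. -/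
inductive Prog where
  | instr (i : Instr)
  | seq (p q : Prog)
  /-- if `M[a] ≤ M[b]` then `p` else `q` -/
  | ite (a b : ℕ) (p q : Prog)
  /-- while `M[a] < M[b]` do `p` -/
  | while (a b : ℕ) (p : Prog)

/-- `Exec s h inp p M M' k`: on a machine with `s` words of memory (addresses `0, …, s - 1`), with
hash function `h` and input `inp`, the program `p` started with memory `M` halts with memory `M'`
after exactly `k` time steps, and never accesses an address outside the memory. -/
inductive Exec (s : ℕ) (h : HashFun) (inp : ℕ → ℝ) : Prog → Mem → Mem → ℕ → Prop where
  | instr {i : Instr} {M : Mem} (hi : ∀ k, i.Touches M k → k < s) :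
      Exec s h inp (.instr i) M (i.apply h inp M) (i.cost M)
  | seq {p q : Prog} {M M' M'' : Mem} {k l : ℕ}
      (hp : Exec s h inp p M M' k) (hq : Exec s h inp q M' M'' l) :
      Exec s h inp (.seq p q) M M'' (k + l)
  | ite_true {a b : ℕ} {p q : Prog} {M M' : Mem} {k : ℕ} (ha : a < s) (hb : b < s)
      (hab : M a ≤ M b) (hp : Exec s h inp p M M' k) :
      Exec s h inp (.ite a b p q) M M' (k + 1)
  | ite_false {a b : ℕ} {p q : Prog} {M M' : Mem} {k : ℕ} (ha : a < s) (hb : b < s)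
      (hab : ¬ M a ≤ M b) (hq : Exec s h inp q M M' k) :
      Exec s h inp (.ite a b p q) M M' (k + 1)
  | while_true {a b : ℕ} {p : Prog} {M M' M'' : Mem} {k l : ℕ} (ha : a < s) (hb : b < s)
      (hab : M a < M b) (hp : Exec s h inp p M M' k)
      (hw : Exec s h inp (.while a b p) M' M'' l) :
      Exec s h inp (.while a b p) M M'' (k + l + 1)
  | while_false {a b : ℕ} {p : Prog} {M : Mem} (ha : a < s) (hb : b < s)
      (hab : ¬ M a < M b) :
      Exec s h inp (.while a b p) M M 1

/-! ### Sliding-window algorithms -/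

/-- A sliding-window algorithm: a program that is run on each arriving point, and a program that
is run to answer a query. -/
structure SWAlgorithm where
  update : Prog
  query : Prog

/-- The memory at the start holds the parameters `d`, `m`, `w`, `α`. -/
noncomputable def initMem (d m w : ℕ) (α : ℝ) : Mem
  | 0 => d
  | 1 => m
  | 2 => w
  | 3 => α
  | _ => 0

/-- The input of the update program: the `d` coordinates of the arriving point, followed by its
arrival time. -/
noncomputable def itemInput {d : ℕ} (x : EuclideanSpace ℝ (Fin d)) (t : ℕ) : ℕ → ℝ :=
  fun k => if hk : k < d then x ⟨k, hk⟩ else if k = d then (t : ℝ) else 0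

/-- The input of the query program: the current time. -/
noncomputable def queryInput (t : ℕ) : ℕ → ℝ :=
  fun k => if k = 0 then (t : ℝ) else 0

/-- The point that a halted query program outputs: its coordinates are stored consecutively, from
the address in word `0` on. -/
noncomputable def outputPoint (d : ℕ) (M : Mem) : EuclideanSpace ℝ (Fin d) :=
  WithLp.toLp 2 fun j : Fin d => M (⌊M 0⌋₊ + j)

/-- What a single word may keep from one item to the next: an integer of `O(log (d * w * m))` bits,
the parameter `α`, or a number copied from the stream (a coordinate or an arrival time). This rules
out packing many numbers into one word. -/
def IsWord {d m : ℕ} (w : ℕ) (α : ℝ) (x : Fin m → EuclideanSpace ℝ (Fin d)) (τ : Fin m → ℕ)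
    (c : ℕ) (v : ℝ) : Prop :=
  (∃ z : ℤ, |z| ≤ ((d * w * m : ℕ) : ℤ) ^ c ∧ v = z) ∨ v = α ∨
    (∃ i j, v = x i j) ∨ (∃ i, v = τ i)

/-- `mem` and `ans` describe the run of the algorithm `A` with hash function `h` on the stream
`(x, τ)`: `mem i` is the memory after `i` items, and `ans t` is the memory in which the query program
halts if it is started at time `t` (a query does not change the stored memory). Throughout the run,
at most `space` words of memory are used, and each item, as well as each query, is processed within
`time` steps. -/
structure IsRun (A : SWAlgorithm) (h : HashFun) {d m : ℕ} (w : ℕ) (α : ℝ)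
    (x : Fin m → EuclideanSpace ℝ (Fin d)) (τ : Fin m → ℕ) (c : ℕ) (space time : ℝ)
    (mem ans : ℕ → Mem) : Prop where
  init : mem 0 = initMem d m w α
  step : ∀ i : Fin m, ∃ k : ℕ, (k : ℝ) ≤ time ∧
    Exec ⌊space⌋₊ h (itemInput (x i) (τ i)) A.update (mem i) (mem (i + 1)) k
  query : ∀ t : ℕ, ∃ k : ℕ, (k : ℝ) ≤ time ∧
    Exec ⌊space⌋₊ h (queryInput t) A.query (mem (arrived τ t)) (ans t) k
  word : ∀ i ≤ m, ∀ a, IsWord w α x τ c (mem i a)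

/-! ### Reasoning about runs of programs -/

/-! Each group of a window is represented by its last item. Since `2 * α < β`, sparsity makes "at
distance at most `α`" transitive on the stream, so these representatives (`latest`) correspond to
the groups of the natural partition, and they do not depend on the hash function. Two stream points
in one grid cell of side `d * α` are at distance at most `√d * (d * α) < β`, hence at most `α`. So
different representatives lie in different cells, and their hash values are independent and uniform
(`near_of_cell_eq`). By symmetry the representative with the least hash value is uniform among them.
This is the sample `u_t` (`hashLaw_argminHash`, `isRobustSample_argminHash`), and it remains to show
that the algorithm finds it in all windows at once.

An item of level `l`, the truncated number of halvings of its hash value, is kept in one of the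
`slotsPerLevel m` slots of level `l`. An arriving item deletes the earlier items of its group and
overwrites the oldest slot of its level. Hence a representative is lost only if, at some moment,
more than `slotsPerLevel m` representatives of its level, none older than it, existed
(`SlotsInv.step`). Expired items are always older than live ones and cannot displace them.

For the window of items `i, …, j - 1`, choose a rate `2⁻ˡ` at which about `clog 2 m` representatives
are expected to have a hash value at most `2⁻ˡ`. A union bound over subsets and the estimate `(1 -
p)ⁿ ≤ exp (-p n)` show that with probability at least `1 - 1/m`, for all pairs `(i, j)` together,
the sample at this rate is nonempty (if `l ≠ 0`) and was never too large at any earlier moment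
(`hashLaw_not_goodSamples_le`). Then the representative with the least hash value has level at least
`l`, so it is still in a slot, and the query returns it, ties being null events (`output_eq`). There
are at most `(m + 1)²` pairs, however many query times there are.

The programs are verified by step-counting Hoare triples `Runs`, which relate the memory to an
abstract state of item counters (`HoldsState`, `SlotStep`). -/

/-- Started with memory `M`, the program `p` halts within `n` steps, with a memory that
satisfies `Q`. -/
def Runs (s : ℕ) (h : HashFun) (inp : ℕ → ℝ) (p : Prog) (n : ℕ) (M : Mem) (Q : Mem → Prop) : Prop :=
  ∃ M' k, Exec s h inp p M M' k ∧ k ≤ n ∧ Q M'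

/-- Sequential composition of a list of programs. -/
def seqs : List Prog → Prog
  | [] => .instr (.const 39 0)
  | [p] => p
  | p :: q :: l => .seq p (seqs (q :: l))

instance : Coe Instr Prog := ⟨Prog.instr⟩

namespace Runs

variable {s : ℕ} {h : HashFun} {inp : ℕ → ℝ} {p q : Prog} {n n' : ℕ} {M : Mem} {Q Q' : Mem → Prop}

theorem mono (hp : Runs s h inp p n M Q) (hn : n ≤ n') (hQ : ∀ M', Q M' → Q' M') :
    Runs s h inp p n' M Q' := by
  obtain ⟨M', k, he, hk, hq⟩ := hp
  exact ⟨M', k, he, hk.trans hn, hQ _ hq⟩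

theorem seq (hp : Runs s h inp p n M fun M' => Runs s h inp q n' M' Q) :
    Runs s h inp (.seq p q) (n + n') M Q := by
  obtain ⟨M', k, he, hk, M'', l, he', hl, hq⟩ := hp
  exact ⟨M'', k + l, .seq he he', by omega, hq⟩

theorem bind (hp : Runs s h inp p n M Q') (hq : ∀ M', Q' M' → Runs s h inp q n' M' Q) :
    Runs s h inp (.seq p q) (n + n') M Q :=
  seq (hp.mono le_rfl hq)

/-- Replaces a concrete memory, which is a tower of `Function.update`, by an arbitrary one with the
properties that matter afterwards. -/
theorem forget {P : Mem → Prop} (hM : P M) (hP : ∀ M, P M → Runs s h inp p n M Q) :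
    Runs s h inp p n M Q :=
  hP M hM

theorem const {a : ℕ} {r : ℚ} (ha : a < s) (hQ : Q (Function.update M a (r : ℝ))) :
    Runs s h inp (.instr (.const a r)) 1 M Q :=
  ⟨_, _, .instr (by simp [Instr.Touches, ha]), le_rfl, hQ⟩

theorem add {a b c : ℕ} (ha : a < s) (hb : b < s) (hc : c < s)
    (hQ : Q (Function.update M a (M b + M c))) : Runs s h inp (.instr (.add a b c)) 1 M Q :=
  ⟨_, _, .instr (by rintro k (rfl | rfl | rfl) <;> assumption), le_rfl, hQ⟩

theorem sub {a b c : ℕ} (ha : a < s) (hb : b < s) (hc : c < s)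
    (hQ : Q (Function.update M a (M b - M c))) : Runs s h inp (.instr (.sub a b c)) 1 M Q :=
  ⟨_, _, .instr (by rintro k (rfl | rfl | rfl) <;> assumption), le_rfl, hQ⟩

theorem mul {a b c : ℕ} (ha : a < s) (hb : b < s) (hc : c < s)
    (hQ : Q (Function.update M a (M b * M c))) : Runs s h inp (.instr (.mul a b c)) 1 M Q :=
  ⟨_, _, .instr (by rintro k (rfl | rfl | rfl) <;> assumption), le_rfl, hQ⟩

theorem div {a b c : ℕ} (ha : a < s) (hb : b < s) (hc : c < s)
    (hQ : Q (Function.update M a (M b / M c))) : Runs s h inp (.instr (.div a b c)) 1 M Q :=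
  ⟨_, _, .instr (by rintro k (rfl | rfl | rfl) <;> assumption), le_rfl, hQ⟩

theorem load {a b : ℕ} (v : ℕ) (hv : M b = v) (ha : a < s) (hb : b < s) (hvs : v < s)
    (hQ : Q (Function.update M a (M v))) : Runs s h inp (.instr (.load a b)) 1 M Q :=
  ⟨_, _, .instr (by rintro k (rfl | rfl | rfl) <;> simp [*]), le_rfl, by
    simpa [Instr.apply, hv] using hQ⟩

theorem store {a b : ℕ} (v : ℕ) (hv : M a = v) (ha : a < s) (hb : b < s) (hvs : v < s)
    (hQ : Q (Function.update M v (M b))) : Runs s h inp (.instr (.store a b)) 1 M Q :=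
  ⟨_, _, .instr (by rintro k (rfl | rfl | rfl) <;> simp [*]), le_rfl, by
    simpa [Instr.apply, hv] using hQ⟩

theorem input {a b : ℕ} (v : ℕ) (hv : M b = v) (ha : a < s) (hb : b < s)
    (hQ : Q (Function.update M a (inp v))) : Runs s h inp (.instr (.input a b)) 1 M Q :=
  ⟨_, _, .instr (by rintro k (rfl | rfl) <;> simp [*]), le_rfl, by
    simpa [Instr.apply, hv] using hQ⟩

theorem hash {a b c : ℕ} (v l : ℕ) (hv : M b = v) (hl : M c = l) (ha : a < s) (hb : b < s)
    (hc : c < s) (hvs : v + l ≤ s)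
    (hQ : Q (Function.update M a (h ((List.range l).map fun k => ⌊M (v + k)⌋) : ℝ))) :
    Runs s h inp (.instr (.hash a b c)) (l + 1) M Q :=
  ⟨_, _, .instr (by
    rintro k (rfl | rfl | rfl | hk) <;> simp_all
    omega), by simp [Instr.cost, hl], by
    simpa [Instr.apply, hv, hl] using hQ⟩

theorem ite {a b : ℕ} (ha : a < s) (hb : b < s) (hp : M a ≤ M b → Runs s h inp p n M Q)
    (hq : ¬ M a ≤ M b → Runs s h inp q n M Q) : Runs s h inp (.ite a b p q) (n + 1) M Q := by
  by_cases hab : M a ≤ M b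
  · obtain ⟨M', k, he, hk, hQ⟩ := hp hab
    exact ⟨M', k + 1, .ite_true ha hb hab he, by omega, hQ⟩
  · obtain ⟨M', k, he, hk, hQ⟩ := hq hab
    exact ⟨M', k + 1, .ite_false ha hb hab he, by omega, hQ⟩

/-- The invariant is indexed by the number of completed rounds, so it fixes their number. Each round
costs one extra step for its test, and the last `+ 1` is the failing test. -/
theorem while_loop {a b N c : ℕ} {I : ℕ → Mem → Prop} (ha : a < s) (hb : b < s) (h0 : I 0 M)
    (hlt : ∀ j < N, ∀ M, I j M → M a < M b) (hend : ∀ M, I N M → ¬ M a < M b)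
    (hbody : ∀ j < N, ∀ M, I j M → Runs s h inp p c M (I (j + 1))) :
    Runs s h inp (.while a b p) (N * (c + 1) + 1) M (I N) := by
  suffices H : ∀ r j, j + r = N → ∀ M, I j M →
      Runs s h inp (.while a b p) (r * (c + 1) + 1) M (I N) from H N 0 (by simp) M h0
  intro r
  induction r with
  | zero =>
    rintro j rfl M hM
    exact ⟨M, 1, .while_false ha hb (hend M hM), by simp, hM⟩
  | succ r ih =>
    intro j hj M hM
    obtain ⟨M', k, he, hk, hM'⟩ := hbody j (by omega) M hM
    obtain ⟨M'', l, he', hl, hM''⟩ := ih (j + 1) (by omega) M' hM'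
    exact ⟨M'', k + l + 1, .while_true ha hb (hlt j (by omega) M hM) he he', by
      rw [Nat.succ_mul]; omega, hM''⟩

end Runs

/-! ### Loops over consecutive words -/

/-- Copies the input words number `0, …, M[33] - 1` to the addresses from `M[20]` on. -/
def copyInput : Prog :=
  seqs [Instr.const 22 0,
    .while 22 33 (seqs [Instr.input 23 22, Instr.add 24 20 22, Instr.store 24 23,
      Instr.add 22 22 5])]

/-- Copies `M[33]` words from the addresses from `M[21]` on to the addresses from `M[20]` on,
multiplying them by `M[32]`. -/
def copyScaled : Prog :=
  seqs [Instr.const 22 0,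
    .while 22 33 (seqs [Instr.add 23 21 22, Instr.load 23 23, Instr.mul 23 23 32,
      Instr.add 24 20 22, Instr.store 24 23, Instr.add 22 22 5])]

/-- Computes in `M[29]` the squared distance of the vectors of length `M[0]` that are stored at the
addresses `M[15]` and `M[26]`. -/
def sqDist : Prog :=
  seqs [Instr.const 22 0, Instr.const 29 0,
    .while 22 0 (seqs [Instr.add 23 15 22, Instr.load 23 23, Instr.add 24 26 22,
      Instr.load 24 24, Instr.sub 23 23 24, Instr.mul 23 23 23, Instr.add 29 29 23,
      Instr.add 22 22 5])]

section Loops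

variable {s : ℕ} {h : HashFun} {inp : ℕ → ℝ} {M : Mem}

/-- The second conjunct is the frame condition: only the target block and the scratch registers 22,
23, 24 can change. All later facts about other words pass through such conditions. -/
theorem copyInput_runs {D N : ℕ} (hs : 40 ≤ s) (hD : 40 ≤ D) (hDs : D + N ≤ s)
    (h20 : M 20 = D) (h33 : M 33 = N) (h5 : M 5 = 1) :
    Runs s h inp copyInput (5 * N + 2) M fun M' =>
      (∀ k < N, M' (D + k) = inp k) ∧
      ∀ a, (a < D ∨ D + N ≤ a) → a ≠ 22 → a ≠ 23 → a ≠ 24 → M' a = M a := by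
  simp only [copyInput, seqs]
  refine Runs.mono (n := 1 + (N * (4 + 1) + 1)) (Runs.seq ?_) (by omega) (fun _ H => H)
  refine Runs.const (by omega) ?_
  refine Runs.mono (Runs.while_loop (I := fun j M' => M' 22 = j ∧ (∀ k < j, M' (D + k) = inp k) ∧
      ∀ a, (a < D ∨ D + N ≤ a) → a ≠ 22 → a ≠ 23 → a ≠ 24 → M' a = M a) (N := N) (c := 4)
      (by omega) (by omega) ?_ ?_ ?_ ?_) le_rfl (fun _ H => H.2)
  · simp +contextual
  · rintro j hj M' ⟨h1, -, h3⟩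
    rw [h1, h3 33 (by omega) (by omega) (by omega) (by omega), h33]
    exact_mod_cast hj
  · rintro M' ⟨h1, -, h3⟩
    rw [h1, h3 33 (by omega) (by omega) (by omega) (by omega), h33]
    simp
  · rintro j hj M' ⟨h1, h2, h3⟩
    have e20 := h3 20 (by omega) (by omega) (by omega) (by omega)
    have e5 := h3 5 (by omega) (by omega) (by omega) (by omega)
    rw [h20] at e20
    rw [h5] at e5
    refine Runs.seq (n := 1) (n' := 3) (Runs.input j h1 (by omega) (by omega) ?_)
    refine Runs.seq (n := 1) (n' := 2) (Runs.add (by omega) (by omega) (by omega) ?_)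
    refine Runs.seq (n := 1) (n' := 1) (Runs.store (D + j) ?_ (by omega) (by omega) (by omega) ?_)
    · simp [e20, h1]
    refine Runs.add (by omega) (by omega) (by omega) ⟨?_, ?_, ?_⟩
    · have : 22 ≠ D + j := by omega
      have : 5 ≠ D + j := by omega
      simp [*]
    · intro k hk
      have : D + k ≠ 22 := by omega
      have : D + k ≠ 23 := by omega
      have : D + k ≠ 24 := by omega
      rcases Nat.lt_succ_iff_lt_or_eq.mp hk with hk | rfl
      · have : k ≠ j := by omega
        simp [*]
      · simp [*]
    · intro a ha h22 h23 h24
      have : a ≠ D + j := by omega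
      simp only [Function.update_apply, *, if_false]
      exact h3 a ha h22 h23 h24

/-- One routine serves three purposes, according to `M 32`: plain copying (factor 1), passing to
grid coordinates (factor `1 / (d * α)`), and erasing (factor 0). -/
theorem copyScaled_runs {D A N : ℕ} (hs : 40 ≤ s) (hD : 40 ≤ D) (hA : 40 ≤ A) (hDs : D + N ≤ s)
    (hAs : A + N ≤ s) (hDA : D + N ≤ A ∨ A + N ≤ D)
    (h20 : M 20 = D) (h21 : M 21 = A) (h33 : M 33 = N) (h5 : M 5 = 1) :
    Runs s h inp copyScaled (7 * N + 2) M fun M' =>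
      (∀ k < N, M' (D + k) = M (A + k) * M 32) ∧
      ∀ a, (a < D ∨ D + N ≤ a) → a ≠ 22 → a ≠ 23 → a ≠ 24 → M' a = M a := by
  simp only [copyScaled, seqs]
  refine Runs.mono (n := 1 + (N * (6 + 1) + 1)) (Runs.seq ?_) (by omega) (fun _ H => H)
  refine Runs.const (by omega) ?_
  refine Runs.mono (Runs.while_loop (I := fun j M' => M' 22 = j ∧
      (∀ k < j, M' (D + k) = M (A + k) * M 32) ∧
      ∀ a, (a < D ∨ D + N ≤ a) → a ≠ 22 → a ≠ 23 → a ≠ 24 → M' a = M a) (N := N) (c := 6)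
      (by omega) (by omega) ?_ ?_ ?_ ?_) le_rfl (fun _ H => H.2)
  · simp +contextual
  · rintro j hj M' ⟨h1, -, h3⟩
    rw [h1, h3 33 (by omega) (by omega) (by omega) (by omega), h33]
    exact_mod_cast hj
  · rintro M' ⟨h1, -, h3⟩
    rw [h1, h3 33 (by omega) (by omega) (by omega) (by omega), h33]
    simp
  · rintro j hj M' ⟨h1, h2, h3⟩
    have e20 := h3 20 (by omega) (by omega) (by omega) (by omega)
    have e21 := h3 21 (by omega) (by omega) (by omega) (by omega)
    have e32 := h3 32 (by omega) (by omega) (by omega) (by omega)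
    have e5 := h3 5 (by omega) (by omega) (by omega) (by omega)
    have eA := h3 (A + j) (by omega) (by omega) (by omega) (by omega)
    rw [h20] at e20
    rw [h21] at e21
    rw [h5] at e5
    refine Runs.seq (n := 1) (n' := 5) (Runs.add (by omega) (by omega) (by omega) ?_)
    refine Runs.seq (n := 1) (n' := 4) (Runs.load (A + j) ?_ (by omega) (by omega) (by omega) ?_)
    · simp [e21, h1]
    refine Runs.seq (n := 1) (n' := 3) (Runs.mul (by omega) (by omega) (by omega) ?_)
    refine Runs.seq (n := 1) (n' := 2) (Runs.add (by omega) (by omega) (by omega) ?_)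
    refine Runs.seq (n := 1) (n' := 1) (Runs.store (D + j) ?_ (by omega) (by omega) (by omega) ?_)
    · simp [e20, h1]
    refine Runs.add (by omega) (by omega) (by omega) ⟨?_, ?_, ?_⟩
    · have : 22 ≠ D + j := by omega
      have : 5 ≠ D + j := by omega
      simp [*]
    · intro k hk
      have : D + k ≠ 22 := by omega
      have : D + k ≠ 23 := by omega
      have : D + k ≠ 24 := by omega
      have : A + j ≠ 23 := by omega
      rcases Nat.lt_succ_iff_lt_or_eq.mp hk with hk | rfl
      · have : k ≠ j := by omega
        simp [*]
      · simp [*]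
    · intro a ha h22 h23 h24
      have : a ≠ D + j := by omega
      simp only [Function.update_apply, *, if_false]
      exact h3 a ha h22 h23 h24

theorem sqDist_runs {B A d : ℕ} (hs : 40 ≤ s) (hB : 40 ≤ B) (hA : 40 ≤ A) (hBs : B + d ≤ s)
    (hAs : A + d ≤ s) (h0 : M 0 = d) (h15 : M 15 = B) (h26 : M 26 = A) (h5 : M 5 = 1) :
    Runs s h inp sqDist (9 * d + 3) M fun M' =>
      M' 29 = ∑ k ∈ Finset.range d, (M (B + k) - M (A + k)) ^ 2 ∧
      ∀ a, a ≠ 22 → a ≠ 23 → a ≠ 24 → a ≠ 29 → M' a = M a := by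
  simp only [sqDist, seqs]
  refine Runs.mono (n := 1 + (1 + (d * (8 + 1) + 1))) (Runs.seq ?_) (by omega) (fun _ H => H)
  refine Runs.const (by omega) (Runs.seq (Runs.const (by omega) ?_))
  refine Runs.mono (Runs.while_loop (I := fun j M' => M' 22 = j ∧
      M' 29 = ∑ k ∈ Finset.range j, (M (B + k) - M (A + k)) ^ 2 ∧
      ∀ a, a ≠ 22 → a ≠ 23 → a ≠ 24 → a ≠ 29 → M' a = M a) (N := d) (c := 8)
      (by omega) (by omega) ?_ ?_ ?_ ?_) le_rfl (fun _ H => H.2)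
  · simp +contextual
  · rintro j hj M' ⟨h1, -, h3⟩
    rw [h1, h3 0 (by omega) (by omega) (by omega) (by omega), h0]
    exact_mod_cast hj
  · rintro M' ⟨h1, -, h3⟩
    rw [h1, h3 0 (by omega) (by omega) (by omega) (by omega), h0]
    simp
  · rintro j hj M' ⟨h1, h2, h3⟩
    have e15 := h3 15 (by omega) (by omega) (by omega) (by omega)
    have e26 := h3 26 (by omega) (by omega) (by omega) (by omega)
    have e5 := h3 5 (by omega) (by omega) (by omega) (by omega)
    have eA := h3 (A + j) (by omega) (by omega) (by omega) (by omega)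
    have eB := h3 (B + j) (by omega) (by omega) (by omega) (by omega)
    rw [h15] at e15
    rw [h26] at e26
    rw [h5] at e5
    refine Runs.seq (n := 1) (n' := 7) (Runs.add (by omega) (by omega) (by omega) ?_)
    refine Runs.seq (n := 1) (n' := 6) (Runs.load (B + j) ?_ (by omega) (by omega) (by omega) ?_)
    · simp [e15, h1]
    refine Runs.seq (n := 1) (n' := 5) (Runs.add (by omega) (by omega) (by omega) ?_)
    refine Runs.seq (n := 1) (n' := 4) (Runs.load (A + j) ?_ (by omega) (by omega) (by omega) ?_)
    · simp [e26, h1]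
    refine Runs.seq (n := 1) (n' := 3) (Runs.sub (by omega) (by omega) (by omega) ?_)
    refine Runs.seq (n := 1) (n' := 2) (Runs.mul (by omega) (by omega) (by omega) ?_)
    refine Runs.seq (n := 1) (n' := 1) (Runs.add (by omega) (by omega) (by omega) ?_)
    have : B + j ≠ 23 := by omega
    have : A + j ≠ 23 := by omega
    have : A + j ≠ 24 := by omega
    refine Runs.add (by omega) (by omega) (by omega) ⟨?_, ?_, ?_⟩
    · simp [*]
    · simp only [Finset.sum_range_succ]
      simp [*]
      ring
    · intro a h22 h23 h24 h29
      simp only [Function.update_apply, *, if_false]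
      exact h3 a h22 h23 h24 h29

end Loops

/-! ### The algorithm -/

/-- One step of the computation of the level of a hash value. -/
noncomputable def levelStep (p : ℝ × ℕ) : ℝ × ℕ := if p.1 ≤ 1 / 2 then (p.1 + p.1, p.2 + 1) else p

/-- The level of a hash value `v`: the largest `l ≤ n` with `v ≤ 2⁻ˡ`. -/
noncomputable def level (n : ℕ) (v : ℝ) : ℕ := (levelStep^[n] (v, 0)).2

/-- The number of slots of a level. -/
def slotsPerLevel (m : ℕ) : ℕ := 128 * Nat.clog 2 m

/-- The total number of slots. -/
def slotCount (m w : ℕ) : ℕ := slotsPerLevel m * (Nat.clog 2 w + 1)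

/-- The address of a slot. A slot holds the coordinates of a point, its arrival time and the number
of items up to and including that point; the latter is `0` if the slot is empty. -/
def slotAddr (d i : ℕ) : ℕ := 41 + 2 * d + i * (d + 2)

/-- Stores constants in the registers. -/
def setConsts : Prog :=
  seqs [Instr.const 5 1, Instr.const 6 0, Instr.const 13 (1 / 2), Instr.const 15 40,
    Instr.add 16 15 0, Instr.add 16 16 5, Instr.add 17 16 0, Instr.add 14 0 5, Instr.add 14 14 5,
    Instr.mul 19 3 3, Instr.mul 12 0 3, Instr.div 12 5 12]

/-- Computes the number of slots per level, the level of the hash value in `M[11]`, and the end of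
the slots. -/
def setSizes : Prog :=
  seqs [Instr.const 34 128, Instr.const 7 0, Instr.const 9 1,
    .while 9 1 (seqs [Instr.add 9 9 9, Instr.add 7 7 34]),
    Instr.const 9 1, Instr.const 8 1, Instr.const 10 0,
    .while 9 2 (seqs [Instr.add 9 9 9, Instr.add 8 8 5,
      .ite 11 13 (seqs [Instr.add 11 11 11, Instr.add 10 10 5]) (Instr.const 35 0)]),
    Instr.mul 18 7 8, Instr.mul 18 18 14, Instr.add 18 18 17]

/-- Empties the slots of all points in the group of the new point. -/
def invalidate : Prog :=
  seqs [Instr.add 26 17 6,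
    .while 26 18 (seqs [sqDist,
      .ite 29 19 (seqs [Instr.add 30 26 0, Instr.add 30 30 5, Instr.store 30 6])
        (Instr.const 30 0),
      Instr.add 26 26 14])]

/-- Finds the oldest slot of the level of the new point. -/
def findOldest : Prog :=
  seqs [Instr.mul 26 10 7, Instr.mul 26 26 14, Instr.add 26 26 17, Instr.mul 25 7 14,
    Instr.add 25 26 25, Instr.add 27 26 6,
    .while 26 25 (seqs [Instr.add 28 27 0, Instr.add 28 28 5, Instr.load 28 28,
      Instr.add 29 26 0, Instr.add 29 29 5, Instr.load 29 29,
      .ite 28 29 (Instr.const 30 0) (Instr.add 27 26 6), Instr.add 26 26 14])]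

/-- Sets registers to `0`. -/
def clear (l : List ℕ) : Prog := seqs (l.map fun a => Instr.const a 0)

/-- Reads the new point, and hashes its cell. -/
def readItem : Prog :=
  seqs [Instr.add 20 15 6, Instr.add 33 0 5, copyInput,
    Instr.add 20 16 6, Instr.add 21 15 6, Instr.add 33 0 6, Instr.add 32 12 6, copyScaled,
    Instr.hash 11 16 0, Instr.const 32 0, copyScaled]

/-- Stores the new point in the slot at the address `M[27]`, and clears the registers. -/
def writeItem : Prog :=
  seqs [Instr.add 4 4 5, Instr.add 20 27 6, Instr.add 21 15 6, Instr.add 33 0 5, Instr.add 32 5 6,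
    copyScaled, Instr.add 30 27 0, Instr.add 30 30 5, Instr.store 30 4,
    clear ((List.range 35).map (· + 5))]

/-- The program that is run on each arriving point. -/
def updateProg : Prog :=
  seqs [setConsts, readItem, setSizes, invalidate, findOldest, writeItem]

/-- Finds, among the points in the slots that have not expired, the one with the least hash
value. -/
def findLeast : Prog :=
  seqs [Instr.input 30 6, Instr.add 27 15 6, Instr.const 28 2, Instr.add 26 17 6,
    .while 26 18 (seqs [Instr.add 31 26 0, Instr.load 35 31, Instr.add 31 31 5, Instr.load 31 31,
      Instr.add 35 35 2,
      .ite 31 6 (Instr.const 36 0) (.ite 35 30 (Instr.const 36 0)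
        (seqs [Instr.add 20 16 6, Instr.add 21 26 6, Instr.add 33 0 6, Instr.add 32 12 6,
          copyScaled, Instr.hash 29 16 0,
          .ite 28 29 (Instr.const 36 0) (seqs [Instr.add 28 29 6, Instr.add 27 26 6])])),
      Instr.add 26 26 14])]

/-- The program that is run to answer a query. -/
def queryProg : Prog := seqs [setConsts, setSizes, findLeast, Instr.add 0 27 6]

/-! ### Specifications of the parts of the algorithm -/

/-- The constants that the registers hold. -/
structure HasConsts (d m w : ℕ) (α : ℝ) (M : Mem) : Prop where
  r0 : M 0 = d
  r1 : M 1 = m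
  r2 : M 2 = w
  r3 : M 3 = α
  r5 : M 5 = 1
  r6 : M 6 = 0
  r12 : M 12 = 1 / (d * α)
  r13 : M 13 = 1 / 2
  r14 : M 14 = (d + 2 : ℕ)
  r15 : M 15 = (40 : ℕ)
  r16 : M 16 = (41 + d : ℕ)
  r17 : M 17 = (41 + 2 * d : ℕ)
  r19 : M 19 = α * α

theorem HasConsts.congr {d m w : ℕ} {α : ℝ} {M M' : Mem} (hM : HasConsts d m w α M)
    (h : ∀ a < 20, M' a = M a) : HasConsts d m w α M' := by
  constructor <;> rw [h _ (by omega)]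
  exacts [hM.r0, hM.r1, hM.r2, hM.r3, hM.r5, hM.r6, hM.r12, hM.r13, hM.r14, hM.r15, hM.r16, hM.r17,
    hM.r19]

/-- The sizes that the registers hold. -/
structure HasSizes (d m w : ℕ) (M : Mem) : Prop where
  r7 : M 7 = (slotsPerLevel m : ℕ)
  r18 : M 18 = (slotAddr d (slotCount m w) : ℕ)

theorem HasSizes.congr {d m w : ℕ} {M M' : Mem} (hM : HasSizes d m w M)
    (h : ∀ a < 20, M' a = M a) : HasSizes d m w M' := by
  constructor <;> rw [h _ (by omega)]
  exacts [hM.r7, hM.r18]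

section Parts

variable {s : ℕ} {h : HashFun} {inp : ℕ → ℝ} {M : Mem} {d m w : ℕ} {α : ℝ}

/-- Memory layout: words 0 to 4 are permanent (the parameters and the item count), 5 to 39 are
scratch registers, `40, …, 40 + d` hold the current item with its time, the next `d` words hold
scaled coordinates, and the slots start at `41 + 2 * d`. -/
theorem setConsts_runs (hs : 40 ≤ s) (h0 : M 0 = d) (h1 : M 1 = m) (h2 : M 2 = w) (h3 : M 3 = α) :
    Runs s h inp setConsts 12 M fun M' =>
      HasConsts d m w α M' ∧ ∀ a, (a < 5 ∨ 20 ≤ a) → M' a = M a := by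
  simp only [setConsts, seqs]
  refine Runs.mono (n := 1 + (1 + (1 + (1 + (1 + (1 + (1 + (1 + (1 + (1 + (1 + 1)))))))))))
    ?_ (by omega) (fun _ H => H)
  iterate 4 refine Runs.seq (Runs.const (by omega) ?_)
  iterate 5 refine Runs.seq (Runs.add (by omega) (by omega) (by omega) ?_)
  iterate 2 refine Runs.seq (Runs.mul (by omega) (by omega) (by omega) ?_)
  refine Runs.div (by omega) (by omega) (by omega) ⟨?_, ?_⟩
  · constructor <;> simp [h0, h1, h2, h3] <;> ring
  · intro a ha
    repeat rw [Function.update_of_ne (by omega)]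

/-- After `j` doublings register 9 holds `2 ^ j`, so the loops run exactly `clog 2 m` and `clog 2 w`
rounds. The second one also performs one `levelStep` per round. Nothing is assumed about `M 11`, so
that queries can use this program too. -/
theorem setSizes_runs (hs : 40 ≤ s) (hM : HasConsts d m w α M) :
    Runs s h inp setSizes (10 + 3 * Nat.clog 2 m + 1 + 6 * Nat.clog 2 w + 1) M fun M' =>
      HasConsts d m w α M' ∧ HasSizes d m w M' ∧ M' 10 = level (Nat.clog 2 w) (M 11) ∧
      ∀ a, (a < 5 ∨ 40 ≤ a) → M' a = M a := by
  simp only [setSizes, seqs]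
  refine Runs.mono (n := 1 + (1 + (1 + ((Nat.clog 2 m * (2 + 1) + 1) + (1 + (1 + (1 +
    ((Nat.clog 2 w * (5 + 1) + 1) + (1 + (1 + 1)))))))))) ?_ (by omega) (fun _ H => H)
  iterate 3 refine Runs.seq (Runs.const (by omega) ?_)
  refine Runs.bind (Runs.while_loop (I := fun j M' => M' 9 = (2 ^ j : ℕ) ∧ M' 7 = (128 * j : ℕ) ∧
    M' 34 = 128 ∧ ∀ a, a ≠ 7 → a ≠ 9 → a ≠ 34 → M' a = M a) (by omega) (by omega)
    ?_ ?_ ?_ ?_) ?_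
  · simp +contextual
  · rintro j hj M' ⟨e9, e7, e34, e⟩
    rw [e9, e 1 (by omega) (by omega) (by omega), hM.r1]
    exact_mod_cast Nat.pow_lt_of_lt_clog hj
  · rintro M' ⟨e9, e7, e34, e⟩
    rw [e9, e 1 (by omega) (by omega) (by omega), hM.r1, not_lt]
    exact_mod_cast Nat.le_pow_clog (by norm_num) m
  · rintro j hj M' ⟨e9, e7, e34, e⟩
    refine Runs.seq (n := 1) (n' := 1) (Runs.add (by omega) (by omega) (by omega) ?_)
    refine Runs.add (by omega) (by omega) (by omega) ⟨?_, ?_, ?_, ?_⟩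
    · simp [e9, pow_succ, mul_two]
    · simp [e7, e34]
      ring
    · simp [e34]
    · intro a h7 h9 h34
      simp only [Function.update_apply, *, if_false]
      exact e a h7 h9 h34
  rintro M1 ⟨-, e7, -, e⟩
  iterate 3 refine Runs.seq (Runs.const (by omega) ?_)
  have e11 := e 11 (by omega) (by omega) (by omega)
  refine Runs.bind (Runs.while_loop (I := fun j M' => M' 9 = (2 ^ j : ℕ) ∧ M' 8 = (j + 1 : ℕ) ∧
    M' 11 = (levelStep^[j] (M 11, 0)).1 ∧ M' 10 = (levelStep^[j] (M 11, 0)).2 ∧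
    ∀ a, a ≠ 8 → a ≠ 9 → a ≠ 10 → a ≠ 11 → a ≠ 35 → M' a = M1 a) (by omega) (by omega)
    ?_ ?_ ?_ ?_) ?_
  · simp +contextual [e11]
  · rintro j hj M' ⟨e9, -, -, -, e'⟩
    rw [e9, e' 2 (by omega) (by omega) (by omega) (by omega) (by omega),
      e 2 (by omega) (by omega) (by omega), hM.r2]
    exact_mod_cast Nat.pow_lt_of_lt_clog hj
  · rintro M' ⟨e9, -, -, -, e'⟩
    rw [e9, e' 2 (by omega) (by omega) (by omega) (by omega) (by omega),
      e 2 (by omega) (by omega) (by omega), hM.r2, not_lt]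
    exact_mod_cast Nat.le_pow_clog (by norm_num) w
  · rintro j hj M' ⟨e9, e8, e11, e10, e'⟩
    have e5 : M' 5 = 1 := by
      rw [e' 5 (by omega) (by omega) (by omega) (by omega) (by omega),
        e 5 (by omega) (by omega) (by omega), hM.r5]
    have e13 : M' 13 = 1 / 2 := by
      rw [e' 13 (by omega) (by omega) (by omega) (by omega) (by omega),
        e 13 (by omega) (by omega) (by omega), hM.r13]
    refine Runs.seq (n := 1) (n' := 4) (Runs.add (by omega) (by omega) (by omega) ?_)
    refine Runs.seq (n := 1) (n' := 3) (Runs.add (by omega) (by omega) (by omega) ?_)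
    simp only [Function.iterate_succ_apply']
    generalize levelStep^[j] (M 11, 0) = p at *
    refine Runs.ite (n := 2) (by omega) (by omega) (fun hab => ?_) (fun hab => ?_)
    · refine Runs.seq (n := 1) (n' := 1) (Runs.add (by omega) (by omega) (by omega) ?_)
      have : p.1 ≤ 1 / 2 := by simpa [e11, e13] using hab
      refine Runs.add (by omega) (by omega) (by omega) ⟨?_, ?_, ?_, ?_, ?_⟩
      · simp [e9, pow_succ, mul_two]
      · simp [e8, e5]
      · simp [levelStep, e11, this, -one_div]
      · simp [levelStep, e10, e5, this, -one_div]
      · intro a h1 h2 h3 h4 h5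
        simp only [Function.update_apply, *, if_false]
        exact e' a h1 h2 h3 h4 h5
    · have : ¬ p.1 ≤ 1 / 2 := by simpa [e11, e13] using hab
      refine Runs.mono (Runs.const (by omega) ⟨?_, ?_, ?_, ?_, ?_⟩) (by omega) (fun _ H => H)
      · simp [e9, pow_succ, mul_two]
      · simp [e8, e5]
      · simp [levelStep, e11, this, -one_div]
      · simp [levelStep, e10, this, -one_div]
      · intro a h1 h2 h3 h4 h5
        simp only [Function.update_apply, *, if_false]
        exact e' a h1 h2 h3 h4 h5
  rintro M2 ⟨-, e8, -, e10, e'⟩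
  have E : ∀ a, a ≠ 7 → a ≠ 8 → a ≠ 9 → a ≠ 10 → a ≠ 11 → a ≠ 34 → a ≠ 35 → M2 a = M a :=
    fun a h7 h8 h9 h10 h11 h34 h35 => by rw [e' a h8 h9 h10 h11 h35, e a h7 h9 h34]
  have E7 : M2 7 = slotsPerLevel m := by
    rw [e' 7 (by omega) (by omega) (by omega) (by omega) (by omega), e7, slotsPerLevel]
  iterate 2 refine Runs.seq (Runs.mul (by omega) (by omega) (by omega) ?_)
  refine Runs.add (by omega) (by omega) (by omega) ⟨?_, ⟨?_, ?_⟩, ?_, ?_⟩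
  · constructor <;> simp [E, hM.r0, hM.r1, hM.r2, hM.r3, hM.r5, hM.r6,
      hM.r12, hM.r13, hM.r14, hM.r15, hM.r16, hM.r17, hM.r19]
  · simp [E7]
  · simp [E7, E, e8, hM.r14, hM.r17, slotAddr, slotCount]
    ring
  · simp [e10, level]
  · intro a ha
    repeat rw [Function.update_of_ne (by omega)]
    exact E a (by omega) (by omega) (by omega) (by omega) (by omega) (by omega) (by omega)

theorem clear_runs {l : List ℕ} (hl : l ≠ []) (hl' : ∀ a ∈ l, a < s) :
    Runs s h inp (clear l) l.length M fun M' =>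
      (∀ a ∈ l, M' a = 0) ∧ ∀ a ∉ l, M' a = M a := by
  induction l generalizing M with
  | nil => exact absurd rfl hl
  | cons b l ih =>
    rcases l with - | ⟨c, l⟩
    · simp only [clear, List.map, seqs]
      refine Runs.const (hl' b (by simp)) ?_
      simp +contextual
    · refine Runs.mono (n := 1 + (c :: l).length)
        (Runs.seq (Runs.const (hl' b (by simp)) (Runs.mono
          (ih (by simp) (fun a ha => hl' a (by simp_all))) le_rfl ?_)))
        (by simp; omega) (fun _ H => H)
      rintro M' ⟨h1, h2⟩
      refine ⟨fun a ha => ?_, fun a ha => ?_⟩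
      · by_cases hac : a ∈ c :: l
        · exact h1 a hac
        · rw [h2 a hac]
          have : a = b := by simp_all
          simp [this]
      · rw [h2 a (by simp_all), Function.update_of_ne (by simp_all)]

theorem slotAddr_succ (d i : ℕ) : slotAddr d (i + 1) = slotAddr d i + (d + 2) := by
  simp only [slotAddr]; ring

theorem slotAddr_mono (d : ℕ) {i j : ℕ} (hij : i ≤ j) : slotAddr d i ≤ slotAddr d j := by
  have := Nat.mul_le_mul_right (d + 2) hij
  simp only [slotAddr]
  omega

theorem slotAddr_ge (d i : ℕ) : 41 + 2 * d ≤ slotAddr d i := Nat.le_add_right _ _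

theorem slotAddr_lt {i j : ℕ} (hij : i < j) : slotAddr d i + (d + 2) ≤ slotAddr d j := by
  rw [← slotAddr_succ]; exact slotAddr_mono d hij

/-- Slots are disjoint consecutive blocks of `d + 2` words. -/
theorem slotAddr_add_inj {i j k l : ℕ} (hk : k < d + 2) (hl : l < d + 2)
    (hij : slotAddr d i + k = slotAddr d j + l) : i = j ∧ k = l := by
  rcases lt_trichotomy i j with hlt | rfl | hlt
  · have := slotAddr_lt (d := d) hlt; omega
  · exact ⟨rfl, by omega⟩
  · have := slotAddr_lt (d := d) hlt; omega

end Parts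

/-! ### Passes over the slots: removal of a group and search for the oldest item -/

section Passes

variable {s : ℕ} {h : HashFun} {inp : ℕ → ℝ} {M : Mem} {d m w : ℕ} {α : ℝ}

open Classical in
/-- The item counter that slot `i` holds after the group of the point `y` has been removed. -/
noncomputable def counterAfter (d : ℕ) (α : ℝ) (y : ℕ → ℝ) (M : Mem) (i : ℕ) : ℝ :=
  if ∑ k ∈ Finset.range d, (y k - M (slotAddr d i + k)) ^ 2 ≤ α * α then 0
  else M (slotAddr d i + (d + 1))

/-- Only the item counter of a slot is set to zero; the coordinates and the time stay behind as
stale data. Stale slots are tested like the others. -/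
theorem invalidate_runs (hs : slotAddr d (slotCount m w) ≤ s) (hM : HasConsts d m w α M)
    (hM' : HasSizes d m w M) :
    Runs s h inp invalidate (slotCount m w * (9 * d + 9) + 2) M fun M' =>
      (∀ i < slotCount m w, M' (slotAddr d i + (d + 1)) =
        counterAfter d α (fun k => M (40 + k)) M i) ∧
      (∀ a < 20, M' a = M a) ∧
      ∀ a ≥ 40, (∀ i < slotCount m w, a ≠ slotAddr d i + (d + 1)) → M' a = M a := by
  have hs0 := slotAddr_ge d (slotCount m w)
  simp only [invalidate, seqs]
  refine Runs.mono (n := 1 + (slotCount m w * ((9 * d + 3) + (4 + 1) + 1) + 1))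
    (Runs.seq (Runs.add (by omega) (by omega) (by omega) ?_))
    (by rw [show 9 * d + 3 + (4 + 1) + 1 = 9 * d + 9 by ring]; omega) (fun _ H => H)
  refine Runs.mono (Runs.while_loop (I := fun j M' => M' 26 = (slotAddr d j : ℕ) ∧
      (∀ i < j, M' (slotAddr d i + (d + 1)) = counterAfter d α (fun k => M (40 + k)) M i) ∧
      (∀ a < 20, M' a = M a) ∧
      ∀ a ≥ 40, (∀ i < j, a ≠ slotAddr d i + (d + 1)) → M' a = M a)
      (by omega) (by omega) ?_ ?_ ?_ ?_) le_rfl (fun _ H => H.2)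
  · refine ⟨by simp [hM.r17, hM.r6, slotAddr], by simp, fun a ha => ?_, fun a ha _ => ?_⟩ <;>
      rw [Function.update_of_ne (by omega)]
  · rintro j hj M1 ⟨e26, -, e, -⟩
    have := slotAddr_lt (d := d) hj
    rw [e26, e 18 (by omega), hM'.r18, Nat.cast_lt]
    omega
  · rintro M1 ⟨e26, -, e, -⟩
    rw [e26, e 18 (by omega), hM'.r18]
    simp
  · rintro j hj M1 ⟨e26, e1, e2, e3⟩
    have hC := hM.congr e2
    have hlt := slotAddr_lt (d := d) hj
    have hge := slotAddr_ge d j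
    refine Runs.mono (n := (9 * d + 3) + (4 + 1)) (Runs.bind (sqDist_runs (by omega) le_rfl
      (show 40 ≤ slotAddr d j by omega) (by omega) (by omega) hC.r0 hC.r15 e26 hC.r5) ?_) le_rfl (fun _ H => H)
    rintro M2 ⟨f29, f⟩
    have hj1 : ∀ k < d + 2, ∀ i < j, slotAddr d j + k ≠ slotAddr d i + (d + 1) := by
      intro k hk i hi heq
      have := (slotAddr_add_inj hk (by omega) heq).1
      omega
    have hval : M2 29 = ∑ k ∈ Finset.range d, (M (40 + k) - M (slotAddr d j + k)) ^ 2 := by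
      rw [f29]
      refine Finset.sum_congr rfl fun k hk => ?_
      have hk : k < d := by simpa using hk
      rw [e3 (40 + k) (by omega) (fun i hi => by have := slotAddr_ge d i; omega),
        e3 (slotAddr d j + k) (by omega) (hj1 k (by omega))]
    have h19 : M2 19 = α * α := by rw [f 19 (by omega) (by omega) (by omega) (by omega), hC.r19]
    have h26 : M2 26 = slotAddr d j := by
      rw [f 26 (by omega) (by omega) (by omega) (by omega), e26]
    have h14 : M2 14 = (d + 2 : ℕ) := by
      rw [f 14 (by omega) (by omega) (by omega) (by omega), hC.r14]
    have h5 : M2 5 = 1 := by rw [f 5 (by omega) (by omega) (by omega) (by omega), hC.r5]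
    have h6 : M2 6 = 0 := by rw [f 6 (by omega) (by omega) (by omega) (by omega), hC.r6]
    have h0 : M2 0 = d := by rw [f 0 (by omega) (by omega) (by omega) (by omega), hC.r0]
    refine Runs.seq (n := 4) (n' := 1) (Runs.ite (n := 3) (by omega) (by omega)
      (fun hab => ?_) (fun hab => ?_))
    · rw [hval, h19] at hab
      refine Runs.seq (n := 1) (n' := 2) (Runs.add (by omega) (by omega) (by omega) ?_)
      refine Runs.seq (n := 1) (n' := 1) (Runs.add (by omega) (by omega) (by omega) ?_)
      refine Runs.store (slotAddr d j + (d + 1)) ?_ (by omega) (by omega) (by omega) ?_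
      · simp [h26, h0, h5]; ring
      refine Runs.add (by omega) (by omega) (by omega) ⟨?_, ?_, ?_, ?_⟩
      · rw [slotAddr_succ]
        rw [Function.update_self]
        repeat rw [Function.update_of_ne (by omega)]
        rw [h26, h14, ← Nat.cast_add]
      · intro i hi
        have hi1 := slotAddr_ge d i
        rw [Function.update_of_ne (by omega)]
        rcases Nat.lt_succ_iff_lt_or_eq.mp hi with hi | rfl
        · rw [Function.update_of_ne (hj1 (d + 1) (by omega) i hi).symm]
          repeat rw [Function.update_of_ne (by omega)]
          rw [f _ (by omega) (by omega) (by omega) (by omega), e1 i hi]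
        · rw [Function.update_self, counterAfter, if_pos hab]
          simp [h6]
      · intro a ha
        repeat rw [Function.update_of_ne (by omega)]
        rw [f _ (by omega) (by omega) (by omega) (by omega), e2 a ha]
      · intro a ha hne
        have := hne j (by omega)
        repeat rw [Function.update_of_ne (by omega)]
        rw [f _ (by omega) (by omega) (by omega) (by omega), e3 a ha fun i hi => hne i (by omega)]
    · rw [hval, h19] at hab
      refine Runs.mono (n := 1) (Runs.const (by omega) ?_) (by omega) (fun _ H => H)
      refine Runs.add (by omega) (by omega) (by omega) ⟨?_, ?_, ?_, ?_⟩
      · rw [slotAddr_succ]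
        simp [h26, h14]
      · intro i hi
        have hi1 := slotAddr_ge d i
        repeat rw [Function.update_of_ne (by omega)]
        rw [f _ (by omega) (by omega) (by omega) (by omega)]
        rcases Nat.lt_succ_iff_lt_or_eq.mp hi with hi | rfl
        · exact e1 i hi
        · rw [counterAfter, if_neg hab, e3 _ (by omega) (hj1 (d + 1) (by omega))]
      · intro a ha
        repeat rw [Function.update_of_ne (by omega)]
        rw [f _ (by omega) (by omega) (by omega) (by omega), e2 a ha]
      · intro a ha hne
        repeat rw [Function.update_of_ne (by omega)]
        rw [f _ (by omega) (by omega) (by omega) (by omega), e3 a ha fun i hi => hne i (by omega)]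

/-- An empty slot has counter 0, so the minimum picks an empty slot of the level whenever there is
one. -/
theorem findOldest_runs {l K : ℕ} (hs : slotAddr d ((l + 1) * K) ≤ s) (hM : HasConsts d m w α M)
    (hK : 0 < K) (h7 : M 7 = (K : ℕ)) (h10 : M 10 = (l : ℕ)) :
    Runs s h inp findOldest (K * 10 + 7) M fun M' =>
      (∃ b, l * K ≤ b ∧ b < (l + 1) * K ∧ M' 27 = (slotAddr d b : ℕ) ∧
        ∀ i, l * K ≤ i → i < (l + 1) * K →
          M (slotAddr d b + (d + 1)) ≤ M (slotAddr d i + (d + 1))) ∧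
      ∀ a, (a < 20 ∨ 40 ≤ a) → M' a = M a := by
  have hs0 := slotAddr_ge d ((l + 1) * K)
  simp only [findOldest, seqs]
  refine Runs.mono (n := 1 + (1 + (1 + (1 + (1 + (1 + (K * (9 + 1) + 1))))))) ?_ (by omega)
    (fun _ H => H)
  iterate 2 refine Runs.seq (Runs.mul (by omega) (by omega) (by omega) ?_)
  refine Runs.seq (Runs.add (by omega) (by omega) (by omega) ?_)
  refine Runs.seq (Runs.mul (by omega) (by omega) (by omega) ?_)
  iterate 2 refine Runs.seq (Runs.add (by omega) (by omega) (by omega) ?_)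
  refine Runs.mono (Runs.while_loop (I := fun j M' => M' 26 = (slotAddr d (l * K + j) : ℕ) ∧
      M' 25 = (slotAddr d ((l + 1) * K) : ℕ) ∧
      (∃ b, l * K ≤ b ∧ b < (l + 1) * K ∧ M' 27 = (slotAddr d b : ℕ) ∧
        ∀ i, l * K ≤ i → i < l * K + j →
          M (slotAddr d b + (d + 1)) ≤ M (slotAddr d i + (d + 1))) ∧
      ∀ a, (a < 20 ∨ 40 ≤ a) → M' a = M a)
      (by omega) (by omega) ?_ ?_ ?_ ?_) le_rfl ?_
  · refine ⟨?_, ?_, ⟨l * K, le_rfl, ?_, ?_, fun i hi hi' => by omega⟩, fun a ha => ?_⟩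
    · simp [h7, h10, hM.r14, hM.r17, slotAddr]; ring
    · simp [h7, h10, hM.r14, hM.r17, slotAddr]; ring
    · rw [Nat.succ_mul]; omega
    · simp [h7, h10, hM.r14, hM.r17, hM.r6, slotAddr]; ring
    · repeat rw [Function.update_of_ne (by omega)]
  · rintro j hj M1 ⟨e26, e25, -, -⟩
    have : l * K + j < (l + 1) * K := by rw [Nat.succ_mul]; omega
    have := slotAddr_lt (d := d) this
    rw [e26, e25, Nat.cast_lt]
    omega
  · rintro M1 ⟨e26, e25, -, -⟩
    rw [e26, e25, Nat.succ_mul]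
    simp
  · rintro j hj M1 ⟨e26, e25, ⟨b, hb1, hb2, e27, hb⟩, e⟩
    have hC := hM.congr fun a ha => e a (Or.inl ha)
    have hjlt : l * K + j < (l + 1) * K := by rw [Nat.succ_mul]; omega
    have hlt := slotAddr_lt (d := d) hjlt
    have hlt' := slotAddr_lt (d := d) hb2
    have hge := slotAddr_ge d (l * K + j)
    have hge' := slotAddr_ge d b
    refine Runs.mono (n := 1 + (1 + (1 + (1 + (1 + (1 + ((1 + 1) + 1))))))) ?_ (by omega)
      (fun _ H => H)
    iterate 2 refine Runs.seq (Runs.add (by omega) (by omega) (by omega) ?_)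
    refine Runs.seq (Runs.load (slotAddr d b + (d + 1)) ?_ (by omega) (by omega) (by omega) ?_)
    · simp [e27, hC.r0, hC.r5]; ring
    iterate 2 refine Runs.seq (Runs.add (by omega) (by omega) (by omega) ?_)
    refine Runs.seq (Runs.load (slotAddr d (l * K + j) + (d + 1)) ?_ (by omega) (by omega)
      (by omega) ?_)
    · simp [e26, hC.r0, hC.r5]; ring
    refine Runs.forget (P := fun M2 => M2 28 = M (slotAddr d b + (d + 1)) ∧
      M2 29 = M (slotAddr d (l * K + j) + (d + 1)) ∧ ∀ a, a ≠ 28 → a ≠ 29 → M2 a = M1 a)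
      ⟨?_, ?_, fun a ha ha' => ?_⟩ ?_
    · rw [← e _ (Or.inr (by omega))]
      iterate 3 rw [Function.update_of_ne (by omega)]
      rw [Function.update_self]
      repeat rw [Function.update_of_ne (by omega)]
    · rw [← e _ (Or.inr (by omega)), Function.update_self]
      repeat rw [Function.update_of_ne (by omega)]
    · repeat rw [Function.update_of_ne (by omega)]
    clear hge hge' hlt hlt'
    rintro M2 ⟨f28, f29, f⟩
    have h26 : M2 26 = slotAddr d (l * K + j) := by rw [f 26 (by omega) (by omega), e26]
    have h25 : M2 25 = slotAddr d ((l + 1) * K) := by rw [f 25 (by omega) (by omega), e25]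
    have h14 : M2 14 = (d + 2 : ℕ) := by rw [f 14 (by omega) (by omega), hC.r14]
    have h6 : M2 6 = 0 := by rw [f 6 (by omega) (by omega), hC.r6]
    have h27 : M2 27 = slotAddr d b := by rw [f 27 (by omega) (by omega), e27]
    have hsucc : slotAddr d (l * K + (j + 1)) = slotAddr d (l * K + j) + (d + 2) := by
      rw [← add_assoc, slotAddr_succ]
    refine Runs.seq (Runs.ite (by omega) (by omega) (fun hab => ?_) (fun hab => ?_))
    · rw [f28, f29] at hab
      refine Runs.const (by omega) (Runs.add (by omega) (by omega) (by omega) ⟨?_, ?_, ?_, ?_⟩)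
      · simp [hsucc, h26, h14]
      · simp [h25]
      · refine ⟨b, hb1, hb2, by simp [h27], fun i hi hi' => ?_⟩
        rcases Nat.lt_succ_iff_lt_or_eq.mp hi' with hi' | rfl
        · exact hb i hi hi'
        · exact hab
      · intro a ha
        repeat rw [Function.update_of_ne (by omega)]
        rw [f a (by omega) (by omega), e a ha]
    · rw [f28, f29, not_le] at hab
      refine Runs.add (by omega) (by omega) (by omega)
        (Runs.add (by omega) (by omega) (by omega) ⟨?_, ?_, ?_, ?_⟩)
      · simp [hsucc, h26, h14]
      · simp [h25]
      · refine ⟨l * K + j, by omega, hjlt, by simp [h26, h6], fun i hi hi' => ?_⟩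
        rcases Nat.lt_succ_iff_lt_or_eq.mp hi' with hi' | rfl
        · exact hab.le.trans (hb i hi hi')
        · exact le_rfl
      · intro a ha
        repeat rw [Function.update_of_ne (by omega)]
        rw [f a (by omega) (by omega), e a ha]
  · rintro M1 ⟨-, -, hb, e⟩
    rw [← Nat.succ_mul] at hb
    exact ⟨hb, e⟩

end Passes

/-! ### Grid cells and the search for the least hash value -/

/-- The list of integers that is hashed for a point with the given coordinates: the cell of the grid
of side length `d * α` that contains the point. -/
noncomputable def cell (d : ℕ) (α : ℝ) (y : ℕ → ℝ) : List ℤ :=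
  (List.range d).map fun k => ⌊y k * (1 / (d * α))⌋

section FindLeast

variable {s : ℕ} {h : HashFun} {inp : ℕ → ℝ} {M : Mem} {d m w : ℕ} {α : ℝ}

/-- Slot `i` holds a point that has not expired by time `t`. -/
def SlotAlive (d w : ℕ) (t : ℝ) (M : Mem) (i : ℕ) : Prop :=
  0 < M (slotAddr d i + (d + 1)) ∧ t < M (slotAddr d i + d) + w

/-- The hash value of the point in slot `i`. -/
noncomputable def slotHash (h : HashFun) (d : ℕ) (α : ℝ) (M : Mem) (i : ℕ) : ℝ :=
  h (cell d α fun k => M (slotAddr d i + k))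

/-- Hash values are recomputed from the stored coordinates, because a hash value is not a kind of
word that may be kept between items. The first alternative, no live slot, leaves the output
unspecified. -/
theorem findLeast_runs (hs : slotAddr d (slotCount m w) ≤ s) (hM : HasConsts d m w α M)
    (hM' : HasSizes d m w M) :
    Runs s h inp findLeast (slotCount m w * (8 * d + 19) + 5) M fun M' =>
      ((∀ i < slotCount m w, ¬ SlotAlive d w (inp 0) M i) ∨
        ∃ b < slotCount m w, SlotAlive d w (inp 0) M b ∧ M' 27 = (slotAddr d b : ℕ) ∧
          ∀ i < slotCount m w, SlotAlive d w (inp 0) M i → slotHash h d α M b ≤ slotHash h d α M i) ∧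
      ∀ a, (a < 20 ∨ 41 + 2 * d ≤ a) → M' a = M a := by
  have hs0 := slotAddr_ge d (slotCount m w)
  simp only [findLeast, seqs]
  refine Runs.mono (n := 1 + (1 + (1 + (1 + (slotCount m w * (8 * d + 18 + 1) + 1)))))
    (Runs.seq (Runs.input 0 (by simp [hM.r6]) (by omega) (by omega) ?_))
    (by rw [show 8 * d + 18 + 1 = 8 * d + 19 by ring]; omega) (fun _ H => H)
  refine Runs.seq (Runs.add (by omega) (by omega) (by omega) ?_)
  refine Runs.seq (Runs.const (by omega) ?_)
  refine Runs.seq (Runs.add (by omega) (by omega) (by omega) ?_)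
  refine Runs.mono (Runs.while_loop (I := fun j M' => M' 26 = (slotAddr d j : ℕ) ∧ M' 30 = inp 0 ∧
      ((M' 28 = 2 ∧ ∀ i < j, ¬ SlotAlive d w (inp 0) M i) ∨
        ∃ b < j, SlotAlive d w (inp 0) M b ∧ M' 27 = (slotAddr d b : ℕ) ∧
          M' 28 = slotHash h d α M b ∧
          ∀ i < j, SlotAlive d w (inp 0) M i → slotHash h d α M b ≤ slotHash h d α M i) ∧
      ∀ a, (a < 20 ∨ 41 + 2 * d ≤ a) → M' a = M a)
      (by omega) (by omega) ?_ ?_ ?_ ?_) le_rfl ?_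
  · refine ⟨by simp [hM.r17, hM.r6, slotAddr], by simp, Or.inl (by simp), fun a ha => ?_⟩
    repeat rw [Function.update_of_ne (by omega)]
  · rintro j hj M1 ⟨e26, -, -, e⟩
    have := slotAddr_lt (d := d) hj
    rw [e26, e 18 (by omega), hM'.r18, Nat.cast_lt]
    omega
  · rintro M1 ⟨e26, -, -, e⟩
    rw [e26, e 18 (by omega), hM'.r18]
    simp
  · rintro j hj M1 ⟨e26, e30, hI, e⟩
    have hC := hM.congr fun a ha => e a (Or.inl ha)
    have hlt := slotAddr_lt (d := d) hj
    have hge := slotAddr_ge d j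
    refine Runs.mono (n := 1 + (1 + (1 + (1 + (1 + ((8 * d + 12) + 1)))))) ?_ (by omega)
      (fun _ H => H)
    refine Runs.seq (Runs.add (by omega) (by omega) (by omega) ?_)
    refine Runs.seq (Runs.load (slotAddr d j + d) (by simp [e26, hC.r0]) (by omega) (by omega)
      (by omega) ?_)
    refine Runs.seq (Runs.add (by omega) (by omega) (by omega) ?_)
    refine Runs.seq (Runs.load (slotAddr d j + (d + 1)) (by simp [e26, hC.r0, hC.r5, add_assoc])
      (by omega) (by omega) (by omega) ?_)
    refine Runs.seq (Runs.add (by omega) (by omega) (by omega) ?_)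
    refine Runs.forget (P := fun M2 => M2 31 = M (slotAddr d j + (d + 1)) ∧
      M2 35 = M (slotAddr d j + d) + w ∧ ∀ a, a ≠ 31 → a ≠ 35 → M2 a = M1 a)
      ⟨?_, ?_, fun a ha ha' => ?_⟩ ?_
    · rw [← e _ (Or.inr (by omega)), Function.update_of_ne (by omega), Function.update_self]
      repeat rw [Function.update_of_ne (by omega)]
    · rw [← e _ (Or.inr (by omega)), Function.update_self, ← hC.r2]
      iterate 2 rw [Function.update_of_ne (by omega)]
      rw [Function.update_self]
      repeat rw [Function.update_of_ne (by omega)]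
    · repeat rw [Function.update_of_ne (by omega)]
    rintro M2 ⟨f31, f35, f⟩
    have g26 : M2 26 = slotAddr d j := by rw [f 26 (by omega) (by omega), e26]
    have g30 : M2 30 = inp 0 := by rw [f 30 (by omega) (by omega), e30]
    have gC := hC.congr fun a ha => f a (by omega) (by omega)
    have gI : (M2 28 = 2 ∧ ∀ i < j, ¬ SlotAlive d w (inp 0) M i) ∨
        ∃ b < j, SlotAlive d w (inp 0) M b ∧ M2 27 = (slotAddr d b : ℕ) ∧
          M2 28 = slotHash h d α M b ∧
          ∀ i < j, SlotAlive d w (inp 0) M i → slotHash h d α M b ≤ slotHash h d α M i := by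
      rwa [f 27 (by omega) (by omega), f 28 (by omega) (by omega)]
    have gM : ∀ a, (a < 20 ∨ 41 + 2 * d ≤ a) → M2 a = M a := fun a ha => by
      rw [f a (by omega) (by omega), e a ha]
    clear hI f e30 hC
    refine Runs.bind (Q' := fun M3 => M3 26 = slotAddr d j ∧ M3 30 = inp 0 ∧
      ((M3 28 = 2 ∧ ∀ i < j + 1, ¬ SlotAlive d w (inp 0) M i) ∨
        ∃ b < j + 1, SlotAlive d w (inp 0) M b ∧ M3 27 = (slotAddr d b : ℕ) ∧
          M3 28 = slotHash h d α M b ∧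
          ∀ i < j + 1, SlotAlive d w (inp 0) M i →
            slotHash h d α M b ≤ slotHash h d α M i) ∧
      ∀ a, (a < 20 ∨ 41 + 2 * d ≤ a) → M3 a = M a) ?_ ?_
    · have hdead (hj' : ¬ SlotAlive d w (inp 0) M j) : Runs s h inp (.instr (.const 36 0)) 1 M2
          fun M3 => M3 26 = slotAddr d j ∧ M3 30 = inp 0 ∧
          ((M3 28 = 2 ∧ ∀ i < j + 1, ¬ SlotAlive d w (inp 0) M i) ∨
            ∃ b < j + 1, SlotAlive d w (inp 0) M b ∧ M3 27 = (slotAddr d b : ℕ) ∧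
              M3 28 = slotHash h d α M b ∧
              ∀ i < j + 1, SlotAlive d w (inp 0) M i →
                slotHash h d α M b ≤ slotHash h d α M i) ∧
          ∀ a, (a < 20 ∨ 41 + 2 * d ≤ a) → M3 a = M a := by
        refine Runs.const (by omega) ⟨by simp [g26], by simp [g30], ?_, fun a ha => ?_⟩
        · rcases gI with ⟨h28, hI⟩ | ⟨b, hb, hba, h27, h28, hI⟩
          · refine Or.inl ⟨by simp [h28], fun i hi => ?_⟩
            rcases Nat.lt_succ_iff_lt_or_eq.mp hi with hi | rfl
            exacts [hI i hi, hj']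
          · refine Or.inr ⟨b, by omega, hba, by simp [h27], by simp [h28], fun i hi hia => ?_⟩
            rcases Nat.lt_succ_iff_lt_or_eq.mp hi with hi | rfl
            exacts [hI i hi hia, absurd hia hj']
        · rw [Function.update_of_ne (by omega), gM a ha]
      refine Runs.ite (n := 8 * d + 11) (by omega) (by omega) (fun hab => ?_) (fun hab => ?_)
      · rw [f31, gC.r6] at hab
        exact (hdead fun H => absurd H.1 (not_lt.2 hab)).mono (by omega) (fun _ H => H)
      rw [f31, gC.r6, not_le] at hab
      refine Runs.ite (n := 8 * d + 10) (by omega) (by omega) (fun hab' => ?_) (fun hab' => ?_)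
      · rw [f35, g30] at hab'
        exact (hdead fun H => absurd H.2 (not_lt.2 hab')).mono (by omega) (fun _ H => H)
      rw [f35, g30, not_le] at hab'
      have halive : SlotAlive d w (inp 0) M j := ⟨hab, hab'⟩
      clear hdead
      refine Runs.mono (n := 1 + (1 + (1 + (1 + ((7 * d + 2) + ((d + 1) + (2 + 1))))))) ?_ (by omega)
        (fun _ H => H)
      iterate 4 refine Runs.seq (Runs.add (by omega) (by omega) (by omega) ?_)
      refine Runs.bind (copyScaled_runs (D := 41 + d) (A := slotAddr d j) (N := d) (by omega)
        (by omega) (by omega) (by omega) (by omega) (by omega) ?_ ?_ ?_ ?_) ?_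
      · simp [gC.r16, gC.r6]
      · simp [g26, gC.r6]
      · simp [gC.r0, gC.r6]
      · simp [gC.r5]
      rintro M3 ⟨k1, k2⟩
      have l28 : M3 28 = M2 28 := by
        rw [k2 28 (by omega) (by omega) (by omega) (by omega)]; simp
      have l26 : M3 26 = slotAddr d j := by
        rw [k2 26 (by omega) (by omega) (by omega) (by omega)]; simp [g26]
      have l27 : M3 27 = M2 27 := by
        rw [k2 27 (by omega) (by omega) (by omega) (by omega)]; simp
      have l30 : M3 30 = inp 0 := by
        rw [k2 30 (by omega) (by omega) (by omega) (by omega)]; simp [g30]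
      have lM : ∀ a, (a < 20 ∨ 41 + 2 * d ≤ a) → M3 a = M a := by
        intro a ha
        rw [k2 a (by omega) (by omega) (by omega) (by omega)]
        repeat rw [Function.update_of_ne (by omega)]
        rw [gM a ha]
      have l16 : M3 16 = (41 + d : ℕ) := by rw [lM 16 (by omega), hM.r16]
      have l0 : M3 0 = (d : ℕ) := by rw [lM 0 (by omega), hM.r0]
      have l6 : M3 6 = 0 := by rw [lM 6 (by omega), hM.r6]
      have hkey : (List.range d).map (fun k => ⌊M3 (41 + d + k)⌋) =
          cell d α fun k => M (slotAddr d j + k) := by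
        refine List.map_congr_left fun k hk => ?_
        have hk : k < d := by simpa using hk
        rw [k1 k hk]
        repeat rw [Function.update_of_ne (a := slotAddr d j + k) (by omega)]
        rw [gM _ (by omega), Function.update_self]
        repeat rw [Function.update_of_ne (by omega)]
        rw [gC.r12, gC.r6, add_zero]
      refine Runs.seq (Runs.hash (41 + d) d l16 l0 (by omega) (by omega) (by omega) (by omega) ?_)
      rw [hkey]
      change Runs s h inp _ _ (Function.update M3 29 (slotHash h d α M j)) _
      refine Runs.ite (by omega) (by omega) (fun hle => ?_) (fun hle => ?_)
      · have hle : M2 28 ≤ slotHash h d α M j := by simpa [l28] using hle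
        refine Runs.mono (n := 1) (Runs.const (by omega) ⟨by simp [l26], by simp [l30], ?_,
          fun a ha => ?_⟩) (by omega) (fun _ H => H)
        · rcases gI with ⟨h28, hI⟩ | ⟨b, hb, hba, h27, h28, hI⟩
          -- The initial value 2 exceeds every hash value, so the first live slot is always accepted
          -- and this case is impossible.
          · have : slotHash h d α M j ≤ 1 := unitInterval.le_one _
            rw [h28] at hle
            linarith
          · refine Or.inr ⟨b, by omega, hba, by simp [l27, h27], by simp [l28, h28],
              fun i hi hia => ?_⟩
            rcases Nat.lt_succ_iff_lt_or_eq.mp hi with hi | rfl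
            exacts [hI i hi hia, h28 ▸ hle]
        · repeat rw [Function.update_of_ne (by omega)]
          rw [lM a ha]
      · have hle : slotHash h d α M j < M2 28 := by simpa [l28] using hle
        refine Runs.seq (n := 1) (n' := 1) (Runs.add (by omega) (by omega) (by omega) ?_)
        refine Runs.add (by omega) (by omega) (by omega) ⟨by simp [l26], by simp [l30], ?_,
          fun a ha => ?_⟩
        · refine Or.inr ⟨j, by omega, halive, by simp [l26, l6], by simp [l6],
              fun i hi hia => ?_⟩
          rcases Nat.lt_succ_iff_lt_or_eq.mp hi with hi | rfl
          · rcases gI with ⟨h28, hI⟩ | ⟨b, hb, hba, h27, h28, hI⟩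
            · exact absurd hia (hI i hi)
            · exact (h28 ▸ hle).le.trans (hI i hi hia)
          · exact le_rfl
        · repeat rw [Function.update_of_ne (by omega)]
          rw [lM a ha]
    · rintro M3 ⟨k26, k30, kI, k⟩
      refine Runs.add (by omega) (by omega) (by omega) ⟨?_, by simp [k30], by simpa using kI,
        fun a ha => ?_⟩
      · rw [slotAddr_succ]
        simp [k26, k 14, hM.r14]
      · rw [Function.update_of_ne (by omega), k a ha]
  · rintro M1 ⟨-, -, hI, e⟩
    refine ⟨?_, e⟩
    rcases hI with ⟨-, hI⟩ | ⟨b, hb, hba, h27, -, hI⟩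
    exacts [Or.inl hI, Or.inr ⟨b, hb, hba, h27, hI⟩]

end FindLeast

/-! ### Specifications of the complete programs -/

section Programs

variable {s : ℕ} {h : HashFun} {inp : ℕ → ℝ} {M : Mem} {d m w : ℕ} {α : ℝ}

/-- A bound for the number of steps of the update program. -/
def updateCost (d m w : ℕ) : ℕ :=
  150 + 40 * d + 3 * Nat.clog 2 m + 6 * Nat.clog 2 w + slotCount m w * (9 * d + 9) +
    slotsPerLevel m * 10

/-- A bound for the number of steps of the query program. -/
def queryCost (d m w : ℕ) : ℕ :=
  40 + 3 * Nat.clog 2 m + 6 * Nat.clog 2 w + slotCount m w * (8 * d + 19)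

theorem levelStep_iterate_le (n : ℕ) (v : ℝ) : (levelStep^[n] (v, 0)).2 ≤ n := by
  induction n with
  | zero => simp
  | succ n ih =>
    rw [Function.iterate_succ_apply', levelStep]
    split_ifs
    · exact Nat.succ_le_succ ih
    · exact ih.trans (Nat.le_succ n)

theorem level_le (n : ℕ) (v : ℝ) : level n v ≤ n := levelStep_iterate_le n v

theorem queryProg_runs (hs : slotAddr d (slotCount m w) ≤ s) (h0 : M 0 = d) (h1 : M 1 = m)
    (h2 : M 2 = w) (h3 : M 3 = α) :
    Runs s h inp queryProg (queryCost d m w) M fun M' =>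
      ((∀ i < slotCount m w, ¬ SlotAlive d w (inp 0) M i) ∨
        ∃ b < slotCount m w, SlotAlive d w (inp 0) M b ∧ M' 0 = (slotAddr d b : ℕ) ∧
          ∀ i < slotCount m w, SlotAlive d w (inp 0) M i →
            slotHash h d α M b ≤ slotHash h d α M i) ∧
      ∀ a, 41 + 2 * d ≤ a → M' a = M a := by
  have hs0 := slotAddr_ge d (slotCount m w)
  simp only [queryProg, seqs]
  refine Runs.mono (n := 12 + ((10 + 3 * Nat.clog 2 m + 1 + 6 * Nat.clog 2 w + 1) +
    ((slotCount m w * (8 * d + 19) + 5) + 1))) (Runs.bind (setConsts_runs (by omega) h0 h1 h2 h3) ?_)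
    (by simp only [queryCost]; omega) (fun _ H => H)
  rintro M1 ⟨hC, e1⟩
  refine Runs.bind (setSizes_runs (by omega) hC) ?_
  -- In a query, register 11 holds no meaningful hash value; the level computed from it is
  -- discarded.
  rintro M2 ⟨hC2, hS2, -, e2⟩
  refine Runs.bind (findLeast_runs hs hC2 hS2) ?_
  rintro M3 ⟨hI, e3⟩
  have hM : ∀ a, 41 + 2 * d ≤ a → M2 a = M a := fun a ha => by
    rw [e2 a (by omega), e1 a (by omega)]
  have halive : ∀ i, SlotAlive d w (inp 0) M2 i ↔ SlotAlive d w (inp 0) M i := by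
    intro i
    have := slotAddr_ge d i
    simp only [SlotAlive]
    rw [hM _ (by omega), hM _ (by omega)]
  have hhash : ∀ i, slotHash h d α M2 i = slotHash h d α M i := by
    intro i
    have := slotAddr_ge d i
    simp only [slotHash]
    congr 3
    funext k
    exact hM _ (by omega)
  simp only [halive, hhash] at hI
  refine Runs.add (by omega) (by omega) (by omega) ⟨?_, fun a ha => ?_⟩
  · have h6 : M3 6 = 0 := by rw [e3 6 (by omega), hC2.r6]
    simpa [h6] using hI
  · rw [Function.update_of_ne (by omega), e3 a (by omega), hM a ha]

theorem readItem_runs (hs : 41 + 2 * d ≤ s) (hM : HasConsts d m w α M) :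
    Runs s h inp readItem (20 * d + 20) M fun M' =>
      HasConsts d m w α M' ∧ M' 11 = h (cell d α inp) ∧
      (∀ k < d + 1, M' (40 + k) = inp k) ∧ (∀ a, 41 + d ≤ a → a < 41 + 2 * d → M' a = 0) ∧
      ∀ a, a = 4 ∨ 41 + 2 * d ≤ a → M' a = M a := by
  simp only [readItem, seqs]
  refine Runs.mono (n := 1 + (1 + ((5 * (d + 1) + 2) + (1 + (1 + (1 + (1 + ((7 * d + 2) +
    ((d + 1) + (1 + (7 * d + 2))))))))))) ?_ (by omega) (fun _ H => H)
  iterate 2 refine Runs.seq (Runs.add (by omega) (by omega) (by omega) ?_)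
  refine Runs.bind (copyInput_runs (D := 40) (N := d + 1) (by omega) le_rfl (by omega)
    (by simp [hM.r15, hM.r6]) (by simp [hM.r0, hM.r5]) (by simp [hM.r5])) ?_
  rintro M2 ⟨e2', e2⟩
  have C2 : HasConsts d m w α M2 := hM.congr fun a ha => by
    rw [e2 a (by omega) (by omega) (by omega) (by omega)]
    repeat rw [Function.update_of_ne (by omega)]
  replace e2 : ∀ a, a = 4 ∨ 41 + d ≤ a → M2 a = M a := fun a ha => by
    rw [e2 a (by omega) (by omega) (by omega) (by omega)]
    repeat rw [Function.update_of_ne (by omega)]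
  iterate 4 refine Runs.seq (Runs.add (by omega) (by omega) (by omega) ?_)
  refine Runs.bind (copyScaled_runs (D := 41 + d) (A := 40) (N := d) (by omega)
    (by omega) (by omega) (by omega) (by omega) (by omega) (by simp [C2.r16, C2.r6])
    (by simp [C2.r15, C2.r6]) (by simp [C2.r0, C2.r6]) (by simp [C2.r5])) ?_
  rintro M3 ⟨e3', e3⟩
  have C3 : HasConsts d m w α M3 := C2.congr fun a ha => by
    rw [e3 a (by omega) (by omega) (by omega) (by omega)]
    repeat rw [Function.update_of_ne (by omega)]
  have hcell : (List.range d).map (fun k => ⌊M3 (41 + d + k)⌋) = cell d α inp := by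
    refine List.map_congr_left fun k hk => ?_
    have hk : k < d := by simpa using hk
    rw [e3' k hk]
    repeat rw [Function.update_of_ne (a := 40 + k) (by omega)]
    rw [e2' k (by omega), Function.update_self]
    repeat rw [Function.update_of_ne (by omega)]
    rw [C2.r12, C2.r6, add_zero]
  have r20 : M3 20 = (41 + d : ℕ) := by
    rw [e3 20 (by omega) (by omega) (by omega) (by omega)]; simp [C2.r16, C2.r6]
  have r21 : M3 21 = (40 : ℕ) := by
    rw [e3 21 (by omega) (by omega) (by omega) (by omega)]; simp [C2.r15, C2.r6]
  have r33 : M3 33 = (d : ℕ) := by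
    rw [e3 33 (by omega) (by omega) (by omega) (by omega)]; simp [C2.r0, C2.r6]
  replace e3 : ∀ a, (a < 20 ∨ 40 ≤ a) → (a < 41 + d ∨ 41 + 2 * d ≤ a) → M3 a = M2 a :=
    fun a ha ha' => by
      rw [e3 a (by omega) (by omega) (by omega) (by omega)]
      repeat rw [Function.update_of_ne (by omega)]
  clear C2 e3'
  refine Runs.seq (Runs.hash (41 + d) d C3.r16 C3.r0 (by omega) (by omega) (by omega) (by omega) ?_)
  rw [hcell]
  -- The scaled coordinates are not admissible words between items. A second pass with factor 0
  -- erases them.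
  refine Runs.seq (Runs.const (by omega) ?_)
  refine Runs.mono (copyScaled_runs (D := 41 + d) (A := 40) (N := d) (by omega)
    (by omega) (by omega) (by omega) (by omega) (by omega) (by simpa using r20)
    (by simpa using r21) (by simpa using r33) (by simpa using C3.r5)) le_rfl ?_
  rintro M4 ⟨e4', e4⟩
  refine ⟨?_, ?_, fun k hk => ?_, ?_, fun a ha => ?_⟩
  · have h4 : ∀ a < 20, a ≠ 11 → M4 a = M3 a := fun a ha ha' => by
      rw [e4 a (by omega) (by omega) (by omega) (by omega)]
      repeat rw [Function.update_of_ne (by omega)]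
    constructor <;> rw [h4 _ (by omega) (by omega)]
    exacts [C3.r0, C3.r1, C3.r2, C3.r3, C3.r5, C3.r6, C3.r12, C3.r13, C3.r14, C3.r15, C3.r16,
      C3.r17, C3.r19]
  · rw [e4 11 (by omega) (by omega) (by omega) (by omega)]; simp
  · rw [e4 _ (by omega) (by omega) (by omega) (by omega)]
    repeat rw [Function.update_of_ne (by omega)]
    rw [e3 _ (by omega) (by omega), e2' k hk]
  · intro a ha ha'
    obtain ⟨k, rfl⟩ := Nat.exists_eq_add_of_le ha
    rw [e4' k (by omega), Function.update_self]
    simp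
  · rw [e4 _ (by omega) (by omega) (by omega) (by omega)]
    repeat rw [Function.update_of_ne (by omega)]
    rw [e3 a (by omega) (by omega), e2 a (by omega)]

theorem writeItem_runs {A : ℕ} (hA : 41 + 2 * d ≤ A) (hs : A + (d + 2) ≤ s)
    (hM : HasConsts d m w α M) (r27 : M 27 = A) :
    Runs s h inp writeItem (7 * d + 60) M fun M' =>
      (∀ a < 4, M' a = M a) ∧ M' 4 = M 4 + 1 ∧ (∀ a, 5 ≤ a → a < 40 → M' a = 0) ∧
      (∀ k < d + 1, M' (A + k) = M (40 + k)) ∧ M' (A + (d + 1)) = M 4 + 1 ∧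
      ∀ a, 40 ≤ a → (a < A ∨ A + (d + 2) ≤ a) → M' a = M a := by
  simp only [writeItem, seqs]
  refine Runs.mono (n := 1 + (1 + (1 + (1 + (1 + ((7 * (d + 1) + 2) +
    (1 + (1 + (1 + 35))))))))) ?_ (by omega) (fun _ H => H)
  iterate 5 refine Runs.seq (Runs.add (by omega) (by omega) (by omega) ?_)
  refine Runs.bind (copyScaled_runs (D := A) (A := 40) (N := d + 1) (by omega)
    (by omega) (by omega) (by omega) (by omega) (by omega) (by simp [r27, hM.r6])
    (by simp [hM.r15, hM.r6]) (by simp [hM.r0, hM.r5]) (by simp [hM.r5])) ?_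
  rintro M8 ⟨b8, e8⟩
  replace b8 : ∀ k < d + 1, M8 (A + k) = M (40 + k) := fun k hk => by
    rw [b8 k hk]
    repeat rw [Function.update_of_ne (a := 40 + k) (by omega)]
    simp [hM.r5, hM.r6]
  have r8 : M8 4 = M 4 + 1 := by
    rw [e8 4 (by omega) (by omega) (by omega) (by omega)]
    simp [hM.r5]
  have r8' : ∀ a < 4, M8 a = M a := fun a ha => by
    rw [e8 a (by omega) (by omega) (by omega) (by omega)]
    repeat rw [Function.update_of_ne (by omega)]
  have r27' : M8 27 = (A : ℕ) := by
    rw [e8 27 (by omega) (by omega) (by omega) (by omega)]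
    simp [r27]
  have r0' : M8 0 = (d : ℕ) := by rw [r8' 0 (by omega), hM.r0]
  have r5' : M8 5 = 1 := by
    rw [e8 5 (by omega) (by omega) (by omega) (by omega)]
    simp [hM.r5]
  replace e8 : ∀ a, 40 ≤ a → (a < A ∨ A + (d + 1) ≤ a) → M8 a = M a :=
    fun a ha ha' => by
      rw [e8 a (by omega) (by omega) (by omega) (by omega)]
      repeat rw [Function.update_of_ne (by omega)]
  iterate 2 refine Runs.seq (Runs.add (by omega) (by omega) (by omega) ?_)
  refine Runs.seq (Runs.store (A + (d + 1)) (by simp [r27', r0', r5', add_assoc])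
    (by omega) (by omega) (by omega) ?_)
  -- The registers 5 to 39 are cleared because they contain `1 / 2`, `1 / (d * α)`, `α * α` and hash
  -- values, which need not be admissible words between items.
  have hlen : ((List.range 35).map (· + 5)).length = 35 := rfl
  refine Runs.mono (clear_runs (by decide) (fun a ha => ?_)) hlen.le ?_
  · simp only [List.mem_map, List.mem_range] at ha
    omega
  rintro M9 ⟨z9, e9⟩
  replace z9 : ∀ a, 5 ≤ a → a < 40 → M9 a = 0 := fun a ha ha' => z9 a (by
    simp only [List.mem_map, List.mem_range]
    exact ⟨a - 5, by omega, by omega⟩)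
  have s9 : M9 (A + (d + 1)) = M 4 + 1 := by
    rw [e9 _ (by simp only [List.mem_map, List.mem_range]; omega), Function.update_self]
    repeat rw [Function.update_of_ne (by omega)]
    exact r8
  replace e9 : ∀ a, a ≠ A + (d + 1) → (a < 5 ∨ 40 ≤ a) → M9 a = M8 a := fun a ha ha' => by
    rw [e9 _ (by simp only [List.mem_map, List.mem_range]; omega)]
    repeat rw [Function.update_of_ne (by omega)]
  refine ⟨fun a ha => ?_, ?_, z9, fun k hk => ?_, s9, fun a ha ha' => ?_⟩
  · rw [e9 a (by omega) (by omega), r8' a ha]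
  · rw [e9 4 (by omega) (by omega), r8]
  · rw [e9 _ (by omega) (by omega), b8 k hk]
  · rw [e9 _ (by omega) (by omega), e8 _ (by omega) (by omega)]

theorem updateProg_runs (hs : slotAddr d (slotCount m w) ≤ s) (hm : 2 ≤ m) (h0 : M 0 = d)
    (h1 : M 1 = m) (h2 : M 2 = w) (h3 : M 3 = α) :
    Runs s h inp updateProg (updateCost d m w) M fun M' =>
      (∀ a < 4, M' a = M a) ∧ M' 4 = M 4 + 1 ∧ (∀ a, 5 ≤ a → a < 40 → M' a = 0) ∧
      (∀ k < d + 1, M' (40 + k) = inp k) ∧ (∀ a, 41 + d ≤ a → a < 41 + 2 * d → M' a = 0) ∧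
      (∀ a, slotAddr d (slotCount m w) ≤ a → M' a = M a) ∧
      ∃ l b, l = level (Nat.clog 2 w) (h (cell d α inp)) ∧
        l * slotsPerLevel m ≤ b ∧ b < (l + 1) * slotsPerLevel m ∧
        (∀ i, l * slotsPerLevel m ≤ i → i < (l + 1) * slotsPerLevel m →
          counterAfter d α inp M b ≤ counterAfter d α inp M i) ∧
        (∀ k < d + 1, M' (slotAddr d b + k) = inp k) ∧
        M' (slotAddr d b + (d + 1)) = M 4 + 1 ∧
        ∀ i < slotCount m w, i ≠ b → (∀ k < d + 1, M' (slotAddr d i + k) = M (slotAddr d i + k)) ∧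
          M' (slotAddr d i + (d + 1)) = counterAfter d α inp M i := by
  have hs0 := slotAddr_ge d (slotCount m w)
  have hK : 0 < slotsPerLevel m := by
    have := Nat.clog_pos (b := 2) (by norm_num) hm
    simp only [slotsPerLevel]
    omega
  simp only [updateProg, seqs]
  refine Runs.mono (n := 12 + ((20 * d + 20) + ((10 + 3 * Nat.clog 2 m + 1 + 6 * Nat.clog 2 w + 1) +
    ((slotCount m w * (9 * d + 9) + 2) + ((slotsPerLevel m * 10 + 7) + (7 * d + 60))))))
    (Runs.bind (setConsts_runs (by omega) h0 h1 h2 h3) ?_)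
    (by simp only [updateCost]; omega) (fun _ H => H)
  rintro M1 ⟨C1, e1⟩
  refine Runs.bind (readItem_runs (by omega) C1) ?_
  rintro M4 ⟨C4, r11, b4, z4, e4⟩
  replace e4 : ∀ a, a = 4 ∨ 41 + 2 * d ≤ a → M4 a = M a := fun a ha => by
    rw [e4 a ha, e1 a (by omega)]
  refine Runs.bind (setSizes_runs (by omega) C4) ?_
  rintro M5 ⟨C5, S5, r10, e5⟩
  rw [r11] at r10
  refine Runs.bind (invalidate_runs hs C5 S5) ?_
  rintro M6 ⟨c6, e6, e6'⟩
  have C6 := C5.congr e6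
  have S6 := S5.congr e6
  have hl : (level (Nat.clog 2 w) (h (cell d α inp)) + 1) * slotsPerLevel m ≤ slotCount m w := by
    rw [slotCount, mul_comm]
    exact Nat.mul_le_mul_left _ (Nat.succ_le_succ (level_le _ _))
  refine Runs.bind (findOldest_runs ((slotAddr_mono d hl).trans hs) C6 hK S6.r7
    ((e6 10 (by omega)).trans r10)) ?_
  rintro M7 ⟨⟨b, hb1, hb2, r27, hb⟩, e7⟩
  have C7 := C6.congr fun a ha => e7 a (Or.inl ha)
  have hbS : b < slotCount m w := by omega
  have hblt := slotAddr_lt (d := d) hbS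
  have hbge := slotAddr_ge d b
  have hcnt : ∀ i, counterAfter d α (fun k => M5 (40 + k)) M5 i = counterAfter d α inp M i := by
    intro i
    have := slotAddr_ge d i
    simp only [counterAfter]
    rw [e5 _ (by omega), e4 _ (by omega)]
    congr 2
    refine Finset.sum_congr rfl fun k hk => ?_
    have hk : k < d := by simpa using hk
    rw [e5 _ (by omega), b4 k (by omega), e5 _ (by omega), e4 _ (by omega)]
  simp only [hcnt] at c6
  have hne : ∀ i j k, k < d + 1 → slotAddr d i + k ≠ slotAddr d j + (d + 1) := fun i j k hk heq => by
    have := (slotAddr_add_inj (by omega) (by omega) heq).2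
    omega
  have b7 : ∀ k < d + 1, M7 (40 + k) = inp k := fun k hk => by
    rw [e7 _ (by omega), e6' _ (by omega) fun i _ => by have := slotAddr_ge d i; omega,
      e5 _ (by omega), b4 k hk]
  have z7 : ∀ a, 41 + d ≤ a → a < 41 + 2 * d → M7 a = 0 := fun a ha ha' => by
    rw [e7 _ (by omega), e6' _ (by omega) fun i _ => by have := slotAddr_ge d i; omega,
      e5 _ (by omega), z4 a ha ha']
  have f7 : ∀ a, slotAddr d (slotCount m w) ≤ a → M7 a = M a := fun a ha => by
    rw [e7 _ (by omega), e6' _ (by omega) fun i hi => by have := slotAddr_lt (d := d) hi; omega,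
      e5 _ (by omega), e4 a (by omega)]
  have m7 : ∀ i, ∀ k < d + 1, M7 (slotAddr d i + k) = M (slotAddr d i + k) := fun i k hk => by
    have := slotAddr_ge d i
    rw [e7 _ (by omega), e6' _ (by omega) fun j _ => hne i j k hk, e5 _ (by omega), e4 _ (by omega)]
  have c7 : ∀ i < slotCount m w, M7 (slotAddr d i + (d + 1)) = counterAfter d α inp M i :=
    fun i hi => by
      have := slotAddr_ge d i
      rw [e7 _ (by omega), c6 i hi]
  have r4 : M7 4 = M 4 := by rw [e7 4 (by omega), e6 4 (by omega), e5 4 (by omega), e4 4 (by omega)]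
  replace hb : ∀ i, level (Nat.clog 2 w) (h (cell d α inp)) * slotsPerLevel m ≤ i →
      i < (level (Nat.clog 2 w) (h (cell d α inp)) + 1) * slotsPerLevel m →
      counterAfter d α inp M b ≤ counterAfter d α inp M i := fun i hi hi' => by
    rw [← c6 b hbS, ← c6 i (by omega)]
    exact hb i hi hi'
  clear c6 e7 e6 e6' e5 e4 z4 b4 r11 r10 C6 S6 C5 S5 C4 hcnt
  refine Runs.mono (writeItem_runs hbge (by omega) C7 r27) le_rfl ?_
  rintro M8 ⟨g0, g4, g5, gA, gA', g⟩
  refine ⟨fun a ha => ?_, by rw [g4, r4], g5, fun k hk => ?_, fun a ha ha' => ?_, fun a ha => ?_,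
    _, b, rfl, hb1, hb2, hb, fun k hk => ?_, by rw [gA', r4], fun i hi hib => ⟨fun k hk => ?_, ?_⟩⟩
  · rw [g0 a ha]
    interval_cases a
    exacts [C7.r0.trans h0.symm, C7.r1.trans h1.symm, C7.r2.trans h2.symm, C7.r3.trans h3.symm]
  · rw [g _ (by omega) (by omega), b7 k hk]
  · rw [g _ (by omega) (by omega), z7 a ha ha']
  · rw [g _ (by omega) (by omega), f7 a ha]
  · rw [gA k hk, b7 k hk]
  · have hi0 := slotAddr_ge d i
    rcases Nat.lt_or_gt_of_ne hib with hlt | hlt <;> have := slotAddr_lt (d := d) hlt <;>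
      rw [g _ (by omega) (by omega), m7 i k hk]
  · have hi0 := slotAddr_ge d i
    rcases Nat.lt_or_gt_of_ne hib with hlt | hlt <;> have := slotAddr_lt (d := d) hlt <;>
      rw [g _ (by omega) (by omega), c7 i hi]

end Programs

/-! ### The contents of the slots during a run -/

open Classical in
/-- The item counters of the slots after the removal of the points that are near item `i`. -/
noncomputable def removeNear (near : ℕ → ℕ → Prop) (i : ℕ) (st : ℕ → ℕ) (j : ℕ) : ℕ :=
  if st j ≠ 0 ∧ near (st j - 1) i then 0 else st j

/-- The transition of the item counters of the slots when item `i` arrives: points that are near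
item `i` are removed, and then item `i` replaces an oldest item of its level. -/
def SlotStep (near : ℕ → ℕ → Prop) (lev : ℕ → ℕ) (K : ℕ) (i : ℕ) (st st' : ℕ → ℕ) : Prop :=
  ∃ b, lev i * K ≤ b ∧ b < (lev i + 1) * K ∧
    (∀ j, lev i * K ≤ j → j < (lev i + 1) * K → removeNear near i st b ≤ removeNear near i st j) ∧
    st' = Function.update (removeNear near i st) b (i + 1)

/-- Dependent choice along finitely many steps, used to build the memories together with the
abstract counters. -/
theorem exists_seq_of_step {X : Type*} {P : ℕ → X → Prop} {R : ℕ → X → X → Prop} {x₀ : X} {m : ℕ}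
    (h0 : P 0 x₀) (step : ∀ i < m, ∀ a, P i a → ∃ b, R i a b ∧ P (i + 1) b) :
    ∃ f : ℕ → X, f 0 = x₀ ∧ (∀ i ≤ m, P i (f i)) ∧ ∀ i < m, R i (f i) (f (i + 1)) := by
  classical
  let f : ℕ → X := fun n => Nat.rec x₀
    (fun i a => if H : i < m ∧ P i a then (step i H.1 a H.2).choose else a) n
  have hf : ∀ i, (H : i < m ∧ P i (f i)) → f (i + 1) = (step i H.1 (f i) H.2).choose :=
    fun i H => dif_pos H
  have hP : ∀ i ≤ m, P i (f i) := by
    intro i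
    induction i with
    | zero => exact fun _ => h0
    | succ i ih =>
      intro hi
      have H : i < m ∧ P i (f i) := ⟨hi, ih (by omega)⟩
      rw [hf i H]
      exact (step i H.1 (f i) H.2).choose_spec.2
  refine ⟨f, rfl, hP, fun i hi => ?_⟩
  have H : i < m ∧ P i (f i) := ⟨hi, hP i hi.le⟩
  rw [hf i H]
  exact (step i H.1 (f i) H.2).choose_spec.1

/-! ### The memory as a representation of the item counters -/

section Stream

variable {d m : ℕ} (x : Fin m → EuclideanSpace ℝ (Fin d)) (τ : Fin m → ℕ)

/-- The `i`-th point of the stream. -/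
noncomputable def pointAt (i : ℕ) : EuclideanSpace ℝ (Fin d) := if hi : i < m then x ⟨i, hi⟩ else 0

/-- The arrival time of the `i`-th point of the stream. -/
def timeAt (i : ℕ) : ℕ := if hi : i < m then τ ⟨i, hi⟩ else 0

/-- The `i`-th item of the stream, as an input. -/
noncomputable def itemAt (i : ℕ) : ℕ → ℝ := itemInput (pointAt x i) (timeAt τ i)

theorem pointAt_val (i : Fin m) : pointAt x i = x i := by simp [pointAt]

theorem timeAt_val (i : Fin m) : timeAt τ i = τ i := by simp [timeAt]

theorem pointAt_eq {i : ℕ} (hi : i < m) : pointAt x i = x ⟨i, hi⟩ := pointAt_val x ⟨i, hi⟩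

theorem timeAt_eq {i : ℕ} (hi : i < m) : timeAt τ i = τ ⟨i, hi⟩ := timeAt_val τ ⟨i, hi⟩

theorem itemAt_coord (i : ℕ) (k : Fin d) : itemAt x τ i k = pointAt x i k := by
  simp [itemAt, itemInput]

theorem itemAt_time (i : ℕ) : itemAt x τ i d = timeAt τ i := by
  simp [itemAt, itemInput]

/-- Two items are near each other if their distance is at most `α`. -/
def Near (α : ℝ) (i j : ℕ) : Prop := dist (pointAt x i) (pointAt x j) ≤ α

theorem sum_sq_le_iff_near {α : ℝ} (hα : 0 < α) (i j : ℕ) :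
    ∑ k ∈ Finset.range d, (itemAt x τ i k - itemAt x τ j k) ^ 2 ≤ α * α ↔ Near x α j i := by
  rw [Near, dist_comm, EuclideanSpace.dist_eq, Real.sqrt_le_left hα.le, sq α, Finset.sum_range]
  simp only [itemAt_coord, Real.dist_eq, sq_abs]

/-- The memory `M` holds the state after `i` items, with item counters `st` in the slots. -/
structure HoldsState (w : ℕ) (α : ℝ) (i : ℕ) (st : ℕ → ℕ) (M : Mem) : Prop where
  r0 : M 0 = d
  r1 : M 1 = m
  r2 : M 2 = w
  r3 : M 3 = α
  r4 : M 4 = i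
  word : ∀ a, IsWord w α x τ 1 (M a)
  counter : ∀ j < slotCount m w, M (slotAddr d j + (d + 1)) = st j
  counter_le : ∀ j < slotCount m w, st j ≤ m
  item : ∀ j < slotCount m w, st j ≠ 0 → ∀ k < d + 1, M (slotAddr d j + k) = itemAt x τ (st j - 1) k

variable {x τ} {w : ℕ} {α : ℝ}

theorem isWord_natCast {n : ℕ} (hn : n ≤ d * w * m) : IsWord w α x τ 1 (n : ℝ) :=
  Or.inl ⟨n, by rw [pow_one, Nat.abs_cast]; exact_mod_cast hn, by simp⟩

theorem isWord_zero : IsWord w α x τ 1 0 := by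
  simpa using isWord_natCast (x := x) (τ := τ) (w := w) (α := α) (Nat.zero_le _)

theorem isWord_itemAt {i k : ℕ} (hi : i < m) (hk : k < d + 1) :
    IsWord w α x τ 1 (itemAt x τ i k) := by
  rcases Nat.lt_succ_iff_lt_or_eq.mp hk with hk | rfl
  · refine Or.inr (Or.inr (Or.inl ⟨⟨i, hi⟩, ⟨k, hk⟩, ?_⟩))
    rw [← pointAt_eq x hi]
    exact itemAt_coord x τ i ⟨k, hk⟩
  · refine Or.inr (Or.inr (Or.inr ⟨⟨i, hi⟩, ?_⟩))
    rw [itemAt_time, timeAt_eq]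

theorem holdsState_init (hd : 1 ≤ d) (hm : 1 ≤ m) (hw : 1 ≤ w) :
    HoldsState x τ w α 0 0 (initMem d m w α) where
  r0 := rfl
  r1 := rfl
  r2 := rfl
  r3 := rfl
  r4 := by simp [initMem]
  word a := by
    match a with
    | 0 => exact isWord_natCast (Nat.mul_assoc d w m ▸ Nat.le_mul_of_pos_right d (by positivity))
    | 1 => exact isWord_natCast (Nat.le_mul_of_pos_left m (by positivity))
    | 2 =>
      refine isWord_natCast ((Nat.le_mul_of_pos_left w hd).trans (Nat.le_mul_of_pos_right _ hm))
    | 3 => exact Or.inr (Or.inl rfl)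
    | n + 4 => exact isWord_zero
  counter j hj := by
    have := slotAddr_ge d j
    obtain ⟨k, hk⟩ := Nat.exists_eq_add_of_le' (show 4 ≤ slotAddr d j + (d + 1) by omega)
    rw [hk]
    simp [initMem]
  counter_le j hj := by simp
  item j hj h := absurd rfl h

/-- The level of item `i`. -/
noncomputable def levelAt (h : HashFun) (x : Fin m → EuclideanSpace ℝ (Fin d)) (τ : Fin m → ℕ)
    (w : ℕ) (α : ℝ) (i : ℕ) : ℕ :=
  level (Nat.clog 2 w) (h (cell d α (itemAt x τ i)))

/-- For an empty slot the distance test runs on stale coordinates, but both of its outcomes give the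
counter 0. -/
theorem HoldsState.counterAfter {i : ℕ} {st : ℕ → ℕ} {M : Mem} (hM : HoldsState x τ w α i st M)
    (hα : 0 < α) {j : ℕ} (hj : j < slotCount m w) :
    counterAfter d α (itemAt x τ i) M j = removeNear (Near x α) i st j := by
  rw [_root_.counterAfter, removeNear, hM.counter j hj]
  by_cases h0 : st j = 0
  · simp [h0]
  · have : ∑ k ∈ Finset.range d, (itemAt x τ i k - M (slotAddr d j + k)) ^ 2 =
        ∑ k ∈ Finset.range d, (itemAt x τ i k - itemAt x τ (st j - 1) k) ^ 2 :=
      Finset.sum_congr rfl fun k hk => by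
        rw [hM.item j hj h0 k (by have := Finset.mem_range.1 hk; omega)]
    rw [this]
    by_cases hn : Near x α (st j - 1) i
    · rw [if_pos ((sum_sq_le_iff_near x τ hα _ _).2 hn), if_pos ⟨h0, hn⟩, Nat.cast_zero]
    · rw [if_neg fun H => hn ((sum_sq_le_iff_near x τ hα _ _).1 H), if_neg fun H => hn H.2]

theorem removeNear_ne_zero {near : ℕ → ℕ → Prop} {i : ℕ} {st : ℕ → ℕ} {j : ℕ}
    (h : removeNear near i st j ≠ 0) : removeNear near i st j = st j ∧ ¬ near (st j - 1) i := by
  rw [removeNear] at h ⊢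
  split_ifs at h ⊢ with h'
  · exact absurd rfl h
  · exact ⟨rfl, fun hn => h' ⟨h, hn⟩⟩

theorem removeNear_le {near : ℕ → ℕ → Prop} {i : ℕ} {st : ℕ → ℕ} {j : ℕ} :
    removeNear near i st j ≤ st j := by
  rw [removeNear]
  split_ifs <;> simp

theorem exists_slot {S a : ℕ} (h1 : 41 + 2 * d ≤ a) (h2 : a < slotAddr d S) :
    ∃ j < S, ∃ k < d + 2, a = slotAddr d j + k := by
  refine ⟨(a - (41 + 2 * d)) / (d + 2), ?_, (a - (41 + 2 * d)) % (d + 2), Nat.mod_lt _ (by omega), ?_⟩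
  · rw [Nat.div_lt_iff_lt_mul (by omega)]
    simp only [slotAddr] at h2
    omega
  · have := Nat.div_add_mod' (a - (41 + 2 * d)) (d + 2)
    simp only [slotAddr]
    omega

/-- Each update simulates one `SlotStep`. The word condition is checked region by region along the
memory layout; counters are integers at most `m`, and the other words of a new slot are copied from
the stream. -/
theorem HoldsState.step {s : ℕ} {h : HashFun} {i : ℕ} {st : ℕ → ℕ} {M : Mem}
    (hM : HoldsState x τ w α i st M) (hs : slotAddr d (slotCount m w) ≤ s) (hd : 1 ≤ d)
    (hm : 2 ≤ m) (hw : 1 ≤ w) (hα : 0 < α) (hi : i < m) :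
    Runs s h (itemAt x τ i) updateProg (updateCost d m w) M fun M' =>
      ∃ st', SlotStep (Near x α) (levelAt h x τ w α) (slotsPerLevel m) i st st' ∧
        HoldsState x τ w α (i + 1) st' M' := by
  refine (updateProg_runs hs hm hM.r0 hM.r1 hM.r2 hM.r3).mono le_rfl ?_
  rintro M' ⟨e0, e4, e5, ebuf, ez, eend, l, b, rfl, hb1, hb2, hb, enew, enew', eold⟩
  have hl : (level (Nat.clog 2 w) (h (cell d α (itemAt x τ i))) + 1) * slotsPerLevel m
      ≤ slotCount m w := by
    rw [slotCount, mul_comm]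
    exact Nat.mul_le_mul_left _ (Nat.succ_le_succ (level_le _ _))
  have hmd : m ≤ d * w * m := Nat.le_mul_of_pos_left m (by positivity)
  have hw1 : IsWord w α x τ 1 ((i + 1 : ℕ) : ℝ) := isWord_natCast (by omega)
  refine ⟨_, ⟨b, hb1, hb2, fun j hj hj' => ?_, rfl⟩, ?_⟩
  · have := hb j hj hj'
    rwa [hM.counterAfter hα (hb2.trans_le hl), hM.counterAfter hα (hj'.trans_le hl),
      Nat.cast_le] at this
  have hcount : ∀ j < slotCount m w, M' (slotAddr d j + (d + 1)) =
      (Function.update (removeNear (Near x α) i st) b (i + 1) j : ℕ) := by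
    intro j hj
    by_cases hjb : j = b
    · subst hjb
      rw [enew', Function.update_self, hM.r4, Nat.cast_succ]
    · rw [(eold j hj hjb).2, Function.update_of_ne hjb, hM.counterAfter hα hj]
  have hle : ∀ j < slotCount m w,
      Function.update (removeNear (Near x α) i st) b (i + 1) j ≤ m := by
    intro j hj
    by_cases hjb : j = b
    · subst hjb
      rw [Function.update_self]
      omega
    · rw [Function.update_of_ne hjb]
      exact removeNear_le.trans (hM.counter_le j hj)
  refine ⟨by rw [e0 0 (by omega), hM.r0], by rw [e0 1 (by omega), hM.r1],
    by rw [e0 2 (by omega), hM.r2], by rw [e0 3 (by omega), hM.r3],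
    by rw [e4, hM.r4, Nat.cast_succ], fun a => ?_, hcount, hle, fun j hj h0 k hk => ?_⟩
  · rcases lt_or_ge a 4 with ha | ha
    · rw [e0 a ha]
      exact hM.word a
    rcases ha.eq_or_lt with rfl | ha
    · rw [e4, hM.r4, ← Nat.cast_succ]
      exact hw1
    rcases lt_or_ge a 40 with ha' | ha'
    · rw [e5 a ha ha']
      exact isWord_zero
    rcases lt_or_ge a (41 + d) with hb' | hb'
    · obtain ⟨k, rfl⟩ := Nat.exists_eq_add_of_le ha'
      rw [ebuf k (by omega)]
      exact isWord_itemAt hi (by omega)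
    rcases lt_or_ge a (41 + 2 * d) with hc | hc
    · rw [ez a hb' hc]
      exact isWord_zero
    rcases lt_or_ge a (slotAddr d (slotCount m w)) with hS | hS
    · obtain ⟨j, hj, k, hk, rfl⟩ := exists_slot hc hS
      rcases Nat.lt_succ_iff_lt_or_eq.mp hk with hk | rfl
      · by_cases hjb : j = b
        · subst hjb
          rw [enew k hk]
          exact isWord_itemAt hi hk
        · rw [(eold j hj hjb).1 k hk]
          exact hM.word _
      · rw [hcount j hj]
        exact isWord_natCast ((hle j hj).trans hmd)
    · rw [eend a hS]
      exact hM.word a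
  · by_cases hjb : j = b
    · subst hjb
      rw [enew k hk, Function.update_self, Nat.add_sub_cancel]
    · rw [Function.update_of_ne hjb] at h0 ⊢
      have h1 := (removeNear_ne_zero h0).1
      rw [h1] at h0 ⊢
      rw [(eold j hj hjb).1 k hk, hM.item j hj h0 k hk]

end Stream

/-! ### The latest items of the groups -/

/-- Item `k` is the last of its group among the first `j` items. -/
def IsLatest (near : ℕ → ℕ → Prop) (k j : ℕ) : Prop := ∀ k', k < k' → k' < j → ¬ near k k'

open Classical in
/-- The items that are the last of their group among the items `i, …, j - 1`. -/
noncomputable def latest (near : ℕ → ℕ → Prop) (i j : ℕ) : Finset ℕ :=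
  (Finset.Ico i j).filter fun k => IsLatest near k j

theorem mem_latest {near : ℕ → ℕ → Prop} {i j k : ℕ} :
    k ∈ latest near i j ↔ (i ≤ k ∧ k < j) ∧ IsLatest near k j := by
  simp [latest]

open Classical in
/-- The slots contain latest items at their levels, and every latest item is in a slot unless there
have been too many later ones at its level. -/
structure SlotsInv (near : ℕ → ℕ → Prop) (lev : ℕ → ℕ) (K S i : ℕ) (st : ℕ → ℕ) : Prop where
  le : ∀ j < S, st j ≤ i
  isLatest : ∀ j < S, st j ≠ 0 → IsLatest near (st j - 1) i
  level : ∀ j < S, st j ≠ 0 → j / K = lev (st j - 1)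
  inj : ∀ j < S, ∀ j' < S, st j ≠ 0 → st j = st j' → j = j'
  complete : ∀ k < i, IsLatest near k i → (∃ j < S, st j = k + 1) ∨
    ∃ j ≤ i, K < ((latest near k j).filter fun k' => lev k' = lev k).card

theorem slotsInv_zero (near : ℕ → ℕ → Prop) (lev : ℕ → ℕ) (K S : ℕ) :
    SlotsInv near lev K S 0 0 :=
  ⟨by simp, by simp, by simp, by simp, by simp⟩

/-- The only delicate point is an item that is overwritten while still the last of its group. It was
the oldest of its level, so all `K` slots of the level were full and held distinct latest items that
are no older. Together with the arriving item these are `K + 1` witnesses for the second alternative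
of `complete`. That alternative speaks of some past moment, so it persists. -/
theorem SlotsInv.step {near : ℕ → ℕ → Prop} {lev : ℕ → ℕ} {K S i : ℕ} {st st' : ℕ → ℕ}
    (hst : SlotsInv near lev K S i st) (h : SlotStep near lev K i st st')
    (hS : (lev i + 1) * K ≤ S) : SlotsInv near lev K S (i + 1) st' := by
  classical
  obtain ⟨b, hb1, hb2, hb, rfl⟩ := h
  set r := removeNear near i st with hr
  have hbS : b < S := by omega
  have hrst : ∀ {j}, r j ≠ 0 → r j = st j ∧ ¬ near (st j - 1) i := removeNear_ne_zero
  have hlast : ∀ {k}, IsLatest near k i → ¬ near k i → IsLatest near k (i + 1) := by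
    intro k hk hki k' h1 h2
    rcases Nat.lt_succ_iff_lt_or_eq.mp h2 with h2 | rfl
    exacts [hk k' h1 h2, hki]
  have hself : IsLatest near i (i + 1) := fun k' h1 h2 => by omega
  have hdiv : ∀ j, lev i * K ≤ j → j < (lev i + 1) * K → j / K = lev i := fun j h1 h2 =>
    Nat.div_eq_of_lt_le h1 h2
  have hrle : ∀ j < S, r j ≤ i := fun j hj => removeNear_le.trans (hst.le j hj)
  have hrlast : ∀ j < S, r j ≠ 0 → IsLatest near (r j - 1) (i + 1) := fun j hj h0 => by
    have h1 := hrst h0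
    rw [h1.1] at h0 ⊢
    exact hlast (hst.isLatest j hj h0) h1.2
  have hrlev : ∀ j < S, r j ≠ 0 → j / K = lev (r j - 1) := fun j hj h0 => by
    have h1 := hrst h0
    rw [h1.1] at h0 ⊢
    exact hst.level j hj h0
  have hrinj : ∀ j < S, ∀ j' < S, r j ≠ 0 → r j = r j' → j = j' := fun j hj j' hj' h0 he => by
    have h1 := (hrst h0).1
    have h2 := (hrst (he ▸ h0)).1
    exact hst.inj j hj j' hj' (h1 ▸ h0) (by rw [← h1, ← h2, he])
  refine ⟨fun j hj => ?_, fun j hj => ?_, fun j hj => ?_, fun j hj j' hj' => ?_, fun k hk hki => ?_⟩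
  · rw [Function.update_apply]
    split_ifs
    · exact le_rfl
    · exact (hrle j hj).trans (Nat.le_succ i)
  · rw [Function.update_apply]
    split_ifs
    · exact fun _ => hself
    · exact hrlast j hj
  · rw [Function.update_apply]
    split_ifs with hjb
    · subst hjb
      exact fun _ => hdiv _ hb1 hb2
    · exact hrlev j hj
  · rw [Function.update_apply, Function.update_apply]
    split_ifs with h1 h2 h2
    · exact fun _ _ => h1.trans h2.symm
    · intro _ he
      have := hrle j' hj'
      omega
    · intro _ he
      have := hrle j hj
      omega
    · exact hrinj j hj j' hj'
  · rcases Nat.lt_succ_iff_lt_or_eq.mp hk with hk | rfl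
    · have hnear : ¬ near k i := hki i hk (Nat.lt_succ_self i)
      have hki' : IsLatest near k i := fun k' h1 h2 => hki k' h1 (by omega)
      rcases hst.complete k hk hki' with ⟨j, hj, hjk⟩ | ⟨j, hj, hjk⟩
      · have hrj : r j = k + 1 := by
          rw [hr, removeNear, if_neg, hjk]
          rw [hjk, Nat.add_sub_cancel]
          exact fun H => hnear H.2
        by_cases hjb : j = b
        · subst hjb
          refine Or.inr ⟨i + 1, le_rfl, ?_⟩
          have hlevk : lev k = lev i := by
            rw [← hdiv j hb1 hb2, hrlev j hj (by omega), hrj, Nat.add_sub_cancel]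
          -- Minimality of the overwritten counter `k + 1 > 0` shows both that no slot of the level
          -- is empty and that no item in it precedes `k`.
          have hge : ∀ j', lev i * K ≤ j' → j' < (lev i + 1) * K → k + 1 ≤ r j' :=
            fun j' h1 h2 => hrj ▸ hb j' h1 h2
          have hcard : (insert i ((Finset.Ico (lev i * K) ((lev i + 1) * K)).image
              fun j' => r j' - 1)).card = K + 1 := by
            rw [Finset.card_insert_of_notMem, Finset.card_image_of_injOn]
            · rw [Nat.card_Ico, Nat.succ_mul]
              omega
            · intro j1 h1 j2 h2 he
              simp only [Finset.coe_Ico, Set.mem_Ico] at h1 h2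
              have g1 := hge j1 h1.1 h1.2
              have g2 := hge j2 h2.1 h2.2
              exact hrinj j1 (by omega) j2 (by omega) (by omega) (by simp only at he; omega)
            · simp only [Finset.mem_image, Finset.mem_Ico, not_exists, not_and, and_imp]
              intro j1 h1 h2 he
              have g1 := hge j1 h1 h2
              have g2 := hrle j1 (by omega)
              omega
          rw [← Nat.succ_le_iff, Nat.succ_eq_add_one, ← hcard]
          refine Finset.card_le_card fun k' hk' => ?_
          rw [Finset.mem_filter, mem_latest]
          rcases Finset.mem_insert.1 hk' with rfl | hk'
          · exact ⟨⟨⟨by omega, by omega⟩, hself⟩, hlevk.symm⟩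
          · obtain ⟨j1, h1, rfl⟩ := Finset.mem_image.1 hk'
            rw [Finset.mem_Ico] at h1
            have g1 := hge j1 h1.1 h1.2
            have g2 := hrle j1 (by omega)
            refine ⟨⟨⟨by omega, by omega⟩, hrlast j1 (by omega) (by omega)⟩, ?_⟩
            rw [← hrlev j1 (by omega) (by omega), hdiv j1 h1.1 h1.2, hlevk]
        · exact Or.inl ⟨j, hj, by rw [Function.update_of_ne hjb, hrj]⟩
      · exact Or.inr ⟨j, by omega, hjk⟩
    · exact Or.inl ⟨b, hbS, by rw [Function.update_self]⟩

-- If the level of `k` is at least `l`, the items that could have crowded it out are latest items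
-- from `i₀` on, of level at least `l`. The hypothesis says that there never were too many of these.
open Classical in
theorem SlotsInv.exists_slot {near : ℕ → ℕ → Prop} {lev : ℕ → ℕ} {K S i i₀ l : ℕ} {st : ℕ → ℕ}
    (hst : SlotsInv near lev K S i st)
    (hl : ∀ j ≤ i, ((latest near i₀ j).filter fun k => l ≤ lev k).card ≤ K) {k : ℕ}
    (hk : k ∈ latest near i₀ i) (hkl : l ≤ lev k) : ∃ j < S, st j = k + 1 := by
  rw [mem_latest] at hk
  refine (hst.complete k hk.1.2 hk.2).resolve_right ?_
  rintro ⟨j, hj, hjk⟩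
  refine absurd (hjk.trans_le (Finset.card_le_card fun k' hk' => ?_)) (not_lt.2 (hl j hj))
  simp only [Finset.mem_filter, mem_latest] at hk' ⊢
  exact ⟨⟨⟨by omega, hk'.1.1.2⟩, hk'.1.2⟩, hk'.2 ▸ hkl⟩

/-! ### Latest items as representatives of the groups -/

section Groups

variable {near : ℕ → ℕ → Prop} {m : ℕ}

/-- The last item before `j` that is near `k` works, by transitivity. Transitivity is only required
for indices below `m`, since `pointAt` takes the default value 0 beyond the stream. -/
theorem exists_mem_latest (hrefl : ∀ i, near i i)
    (htrans : ∀ i < m, ∀ j < m, ∀ k < m, near i j → near j k → near i k)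
    {i j k : ℕ} (hj : j ≤ m) (hik : i ≤ k) (hkj : k < j) :
    ∃ k' ∈ latest near i j, near k k' := by
  classical
  have hne : ((Finset.Ico k j).filter fun k' => near k k').Nonempty :=
    ⟨k, by simp [hkj, hrefl k]⟩
  obtain ⟨k', hk', hmax⟩ := Finset.exists_max_image _ id hne
  simp only [Finset.mem_filter, Finset.mem_Ico, id, and_imp] at hk' hmax
  refine ⟨k', mem_latest.2 ⟨⟨by omega, by omega⟩, fun l h1 h2 h3 => ?_⟩, hk'.2⟩
  have := hmax l (by omega) h2 (htrans k (by omega) k' (by omega) l (by omega) hk'.2 h3)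
  omega

theorem latest_eq_of_near (hsymm : ∀ i j, near i j → near j i) {i j k k' : ℕ}
    (hk : k ∈ latest near i j) (hk' : k' ∈ latest near i j)
    (h : near k k') : k = k' := by
  rw [mem_latest] at hk hk'
  rcases lt_trichotomy k k' with hlt | heq | hlt
  · exact absurd h (hk.2 k' hlt hk'.1.2)
  · exact heq
  · exact absurd (hsymm _ _ h) (hk'.2 k hlt hk.1.2)

/-- With a fixed left end, groups only accumulate. Sending each representative to the later
representative of its group is injective. -/
theorem card_latest_mono (hrefl : ∀ i, near i i) (hsymm : ∀ i j, near i j → near j i)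
    (htrans : ∀ i < m, ∀ j < m, ∀ k < m, near i j → near j k → near i k)
    {i j j' : ℕ} (hjj : j ≤ j') (hj : j' ≤ m) :
    (latest near i j).card ≤ (latest near i j').card := by
  have hex : ∀ k ∈ latest near i j, ∃ k' ∈ latest near i j', near k k' := fun k hk => by
    rw [mem_latest] at hk
    exact exists_mem_latest hrefl htrans hj hk.1.1 (by omega)
  choose! f hf hf' using hex
  refine Finset.card_le_card_of_injOn f hf fun k hk l hl he => ?_
  have h1 := hf' k hk
  have h2 := hf' l hl
  have h3 := (mem_latest.1 (hf k hk)).1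
  have h4 := (mem_latest.1 hk).1
  have h5 := (mem_latest.1 hl).1
  refine latest_eq_of_near hsymm hk hl
    (htrans k (by omega) (f k) (by omega) l (by omega) h1 (hsymm _ _ ?_))
  rw [he]
  exact h2

end Groups

/-! ### Windows -/

section Window

variable {d m : ℕ} {x : Fin m → EuclideanSpace ℝ (Fin d)} {τ : Fin m → ℕ}

/-- Arrival times increase, so the items that have arrived form an initial segment. With `expired`
this turns every window into an interval of indices. -/
theorem le_iff_lt_arrived (hτ : StrictMono τ) (i : Fin m) (t : ℕ) :
    τ i ≤ t ↔ (i : ℕ) < arrived τ t := by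
  constructor
  · intro h
    have : (Finset.Iic i).card ≤ arrived τ t := Finset.card_le_card fun j hj => by
      simpa using (hτ.monotone (Finset.mem_Iic.1 hj)).trans h
    rwa [Fin.card_Iic] at this
  · intro h
    by_contra hlt
    have : arrived τ t ≤ (Finset.Iio i).card := Finset.card_le_card fun j hj => by
      simp only [Finset.mem_filter, Finset.mem_univ, true_and] at hj
      exact Finset.mem_Iio.2 (hτ.lt_iff_lt.1 (by omega))
    rw [Fin.card_Iio] at this
    omega

theorem arrived_le (τ : Fin m → ℕ) (t : ℕ) : arrived τ t ≤ m := by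
  simpa [arrived] using Finset.card_filter_le (Finset.univ : Finset (Fin m)) fun i => τ i ≤ t

/-- The number of points that have expired by time `t`. -/
def expired {m : ℕ} (τ : Fin m → ℕ) (w t : ℕ) : ℕ := arrived (fun i => τ i + w) t

theorem le_iff_lt_expired (hτ : StrictMono τ) (w : ℕ) (i : Fin m) (t : ℕ) :
    τ i + w ≤ t ↔ (i : ℕ) < expired τ w t :=
  le_iff_lt_arrived (τ := fun i => τ i + w) (fun _ _ h => Nat.add_lt_add_right (hτ h) w) i t

open Classical in
theorem mem_window_iff (hτ : StrictMono τ) {w t : ℕ} {y : EuclideanSpace ℝ (Fin d)} :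
    y ∈ window x τ w t ↔
      ∃ k, expired τ w t ≤ k ∧ k < arrived τ t ∧ pointAt x k = y := by
  simp only [window, Finset.mem_image, Finset.mem_filter, Finset.mem_univ, true_and]
  constructor
  · rintro ⟨i, ⟨h1, h2⟩, rfl⟩
    refine ⟨i, ?_, (le_iff_lt_arrived hτ i t).1 h1, pointAt_val x i⟩
    rw [← not_lt, ← le_iff_lt_expired hτ]
    omega
  · rintro ⟨k, h1, h2, rfl⟩
    have hk : k < m := h2.trans_le (arrived_le τ t)
    refine ⟨⟨k, hk⟩, ⟨(le_iff_lt_arrived hτ _ t).2 h2, ?_⟩, (pointAt_eq x hk).symm⟩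
    rw [← not_lt, ← le_iff_lt_expired hτ w ⟨k, hk⟩] at h1
    omega

/-- The items in a window have distinct arrival times among `w` consecutive integers. This is what
allows the levels to stop at `clog 2 w`. -/
theorem card_latest_le (hτ : StrictMono τ) (near : ℕ → ℕ → Prop) (w t : ℕ) :
    (latest near (expired τ w t) (arrived τ t)).card ≤ w := by
  classical
  refine (Finset.card_filter_le _ _).trans ?_
  have H : ∀ k, expired τ w t ≤ k → (hk : k < arrived τ t) →
      timeAt τ k ≤ t ∧ t < timeAt τ k + w := by
    intro k h1 h2
    have hk : k < m := h2.trans_le (arrived_le τ t)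
    rw [timeAt_eq τ hk]
    refine ⟨(le_iff_lt_arrived hτ ⟨k, hk⟩ t).2 h2, ?_⟩
    rw [← not_lt, ← le_iff_lt_expired hτ w ⟨k, hk⟩] at h1
    omega
  refine (Finset.card_le_card_of_injOn (t := Finset.range w) (fun k => t - timeAt τ k) (fun k hk => ?_)
    fun k hk l hl he => ?_).trans (Finset.card_range w).le
  · simp only [Finset.coe_Ico, Set.mem_Ico] at hk
    have := H k hk.1 hk.2
    simp only [Finset.coe_range, Set.mem_Iio]
    omega
  · simp only [Finset.coe_Ico, Set.mem_Ico] at hk hl he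
    have h1 := H k hk.1 hk.2
    have h2 := H l hl.1 hl.2
    have hkm : k < m := hk.2.trans_le (arrived_le τ t)
    have hlm : l < m := hl.2.trans_le (arrived_le τ t)
    have h3 : timeAt τ k = timeAt τ l := by omega
    rw [timeAt_eq τ hkm, timeAt_eq τ hlm] at h3
    simpa using hτ.injective h3

end Window

/-! ### The law of the hash function -/

instance : IsProbabilityMeasure hashLaw := by unfold hashLaw; infer_instance

section Hash

variable {F : Finset (List ℤ)}

theorem hashLaw_box (F : Finset (List ℤ)) {A : Set unitInterval} (hA : MeasurableSet A) :
    hashLaw.real {h | ∀ c ∈ F, h c ∈ A} = volume.real A ^ F.card := by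
  have : {h : HashFun | ∀ c ∈ F, h c ∈ A} = Set.pi F fun _ => A := by
    ext h; simp [Set.mem_pi]
  rw [this, measureReal_def, hashLaw, Measure.infinitePi_pi _ (fun _ _ => hA)]
  simp [measureReal_def]

-- Union bound over the `K`-subsets of `F`: there are at most `|F|ᴷ / K!` of them, and each is
-- sampled entirely with probability `pᴷ`.
open Classical in
theorem hashLaw_many_le (F : Finset (List ℤ)) (K : ℕ) (p : unitInterval) :
    hashLaw.real {h | K ≤ (F.filter fun c => h c ≤ p).card} ≤
      ((F.card : ℝ) * p) ^ K / K.factorial := by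
  have hsub : {h : HashFun | K ≤ (F.filter fun c => h c ≤ p).card} ⊆
      ⋃ T ∈ F.powersetCard K, {h | ∀ c ∈ T, h c ∈ Set.Iic p} := by
    intro h hh
    obtain ⟨T, hT, hTK⟩ := Finset.exists_subset_card_eq hh
    simp only [Set.mem_iUnion, Finset.mem_powersetCard]
    exact ⟨T, ⟨hT.trans (Finset.filter_subset _ _), hTK⟩, fun c hc => (Finset.mem_filter.1 (hT hc)).2⟩
  refine (measureReal_mono hsub (measure_ne_top _ _)).trans ((measureReal_biUnion_finset_le _ _).trans ?_)
  have hT : ∀ T ∈ F.powersetCard K, hashLaw.real {h | ∀ c ∈ T, h c ∈ Set.Iic p} = (p : ℝ) ^ K := by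
    intro T hT
    rw [hashLaw_box T measurableSet_Iic, (Finset.mem_powersetCard.1 hT).2, measureReal_def,
      unitInterval.volume_Iic, ENNReal.toReal_ofReal p.2.1]
  rw [Finset.sum_congr rfl hT, Finset.sum_const, Finset.card_powersetCard, nsmul_eq_mul, mul_pow,
    mul_comm (_ ^ K), mul_div_assoc, mul_comm]
  exact mul_le_mul_of_nonneg_left (Nat.choose_le_pow_div K F.card) (pow_nonneg p.2.1 K)

theorem hashLaw_none_le (F : Finset (List ℤ)) (p : unitInterval) :
    hashLaw.real {h | ∀ c ∈ F, p < h c} ≤ Real.exp (-(p * F.card)) := by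
  have := hashLaw_box F (A := Set.Ioi p) measurableSet_Ioi
  simp only [Set.mem_Ioi] at this
  rw [this, measureReal_def, unitInterval.volume_Ioi,
    ENNReal.toReal_ofReal (sub_nonneg.2 p.2.2)]
  refine (pow_le_pow_left₀ (sub_nonneg.2 p.2.2) (Real.one_sub_le_exp_neg _) _).trans ?_
  rw [← Real.exp_nat_mul]
  exact Real.exp_le_exp.2 (by linarith)

/-- Two coordinates have the product law, for which the diagonal is null because its sections are
single points. -/
theorem hashLaw_tie {c c' : List ℤ} (hcc : c ≠ c') : hashLaw {h | h c = h c'} = 0 := by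
  have hmap : hashLaw.map (fun h => (h c, h c')) =
      (volume : Measure unitInterval).prod (volume : Measure unitInterval) :=
    Measure.infinitePi_map_eval_prod hcc
  have hD : MeasurableSet {q : unitInterval × unitInterval | q.1 = q.2} :=
    measurableSet_eq_fun measurable_fst measurable_snd
  have h1 : hashLaw {h | h c = h c'} =
      hashLaw.map (fun h => (h c, h c')) {q : unitInterval × unitInterval | q.1 = q.2} := by
    rw [Measure.map_apply (by fun_prop) hD]
    rfl
  rw [h1, hmap, Measure.measure_prod_null hD]
  refine Filter.Eventually.of_forall fun v => ?_
  have : Prod.mk v ⁻¹' {q : unitInterval × unitInterval | q.1 = q.2} = {v} := by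
    ext u
    simp [eq_comm]
  simp [this]

/-- The event that `c` has the least hash value among the lists in `F`. -/
def leastEvent (F : Finset (List ℤ)) (c : List ℤ) : Set HashFun := {h | ∀ c' ∈ F, h c ≤ h c'}

theorem measurableSet_leastEvent (F : Finset (List ℤ)) (c : List ℤ) :
    MeasurableSet (leastEvent F c) := by
  have : leastEvent F c = ⋂ c' ∈ F, {h | h c ≤ h c'} := by
    ext h; simp [leastEvent]
  rw [this]
  exact Finset.measurableSet_biInter _ fun c' _ =>
    measurableSet_le (measurable_pi_apply c) (measurable_pi_apply c')

/-- Permuting the coordinates by the transposition of `c` and `c'` preserves the product law and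
exchanges the two events. -/
theorem hashLaw_leastEvent_swap {c c' : List ℤ} (hc : c ∈ F) (hc' : c' ∈ F) :
    hashLaw (leastEvent F c) = hashLaw (leastEvent F c') := by
  have hmap : hashLaw.map (fun h a => h (Equiv.swap c c' a)) = hashLaw :=
    Measure.map_infinitePi_infinitePi_of_inj (P := fun _ : List ℤ => (volume : Measure unitInterval))
      (Equiv.swap c c').injective
  have hmem : ∀ a, a ∈ F → Equiv.swap c c' a ∈ F := fun a ha => by
    rw [Equiv.swap_apply_def]
    split_ifs <;> assumption
  conv_lhs => rw [← hmap, Measure.map_apply (by fun_prop) (measurableSet_leastEvent F c)]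
  congr 1
  ext h
  simp only [leastEvent, Set.mem_preimage, Set.mem_ofPred_eq, Equiv.swap_apply_left]
  exact ⟨fun H a ha => by simpa using H _ (hmem a ha), fun H a ha => H _ (hmem a ha)⟩

/-- The events for `a ∈ F` cover everything, overlap only in ties, and have equal probability. -/
theorem hashLaw_leastEvent {c : List ℤ} (hc : c ∈ F) :
    hashLaw.real (leastEvent F c) = 1 / F.card := by
  have hunion : (⋃ a ∈ F, leastEvent F a) = Set.univ := by
    refine Set.eq_univ_of_forall fun h => ?_
    obtain ⟨a, ha, hmin⟩ := Finset.exists_min_image F h ⟨c, hc⟩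
    exact Set.mem_biUnion ha hmin
  have hdisj : Set.Pairwise (F : Set (List ℤ)) (Function.onFun (AEDisjoint hashLaw) (leastEvent F)) := by
    intro a ha b hb hab
    refine measure_mono_null (fun h hh => ?_) (hashLaw_tie hab)
    exact le_antisymm (hh.1 b hb) (hh.2 a ha)
  have h1 := measure_biUnion_finset₀ hdisj
    fun a _ => (measurableSet_leastEvent F a).nullMeasurableSet
  rw [hunion, measure_univ, Finset.sum_congr rfl fun a ha => hashLaw_leastEvent_swap ha hc,
    Finset.sum_const, nsmul_eq_mul] at h1
  have h2 := congrArg ENNReal.toReal h1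
  rw [ENNReal.toReal_mul, ENNReal.toReal_one, ENNReal.toReal_natCast, ← measureReal_def] at h2
  have : (F.card : ℝ) ≠ 0 := by
    have := Finset.card_pos.2 ⟨c, hc⟩
    positivity
  field_simp
  linarith

end Hash

/-! ### The item with the least hash value -/

section Argmin

variable {D : Finset ℕ} {key : ℕ → List ℤ}

/-- The first item in `D` with the least hash value. -/
noncomputable def argminHash (D : Finset ℕ) (key : ℕ → List ℤ) (h : HashFun) : ℕ :=
  sInf {k | k ∈ D ∧ ∀ l ∈ D, h (key k) ≤ h (key l)}

theorem argminHash_spec (hD : D.Nonempty) (h : HashFun) :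
    argminHash D key h ∈ D ∧ ∀ l ∈ D, h (key (argminHash D key h)) ≤ h (key l) := by
  obtain ⟨k, hk, hmin⟩ := Finset.exists_min_image D (fun k => h (key k)) hD
  exact Nat.sInf_mem (s := {k | k ∈ D ∧ ∀ l ∈ D, h (key k) ≤ h (key l)}) ⟨k, hk, hmin⟩

theorem measurable_argminHash (hD : D.Nonempty) : Measurable (argminHash D key) := by
  have hmeas : ∀ k, MeasurableSet {h : HashFun | k ∈ D ∧ ∀ l ∈ D, h (key k) ≤ h (key l)} := by
    intro k
    have : {h : HashFun | ∀ l ∈ D, h (key k) ≤ h (key l)} = leastEvent (D.image key) (key k) := by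
      ext h; simp [leastEvent]
    have h1 : MeasurableSet {h : HashFun | ∀ l ∈ D, h (key k) ≤ h (key l)} := by
      rw [this]
      exact measurableSet_leastEvent _ _
    exact (MeasurableSet.const (k ∈ D)).inter h1
  refine measurable_to_countable' fun k => ?_
  have : argminHash D key ⁻¹' {k} = {h | k ∈ D ∧ ∀ l ∈ D, h (key k) ≤ h (key l)} ∩
      ⋂ l ∈ Finset.range k, {h : HashFun | l ∈ D ∧ ∀ l' ∈ D, h (key l) ≤ h (key l')}ᶜ := by
    ext h
    simp only [Set.mem_preimage, Set.mem_singleton_iff, Set.mem_inter_iff, Set.mem_iInter,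
      Finset.mem_range, Set.mem_compl_iff]
    constructor
    · rintro rfl
      exact ⟨argminHash_spec hD h, fun l hl => Nat.notMem_of_lt_sInf hl⟩
    · rintro ⟨h1, h2⟩
      refine le_antisymm (Nat.sInf_le h1) (not_lt.1 fun hlt => h2 _ hlt (argminHash_spec hD h))
  rw [this]
  exact (hmeas k).inter (Finset.measurableSet_biInter _ fun l _ => (hmeas l).compl)

/-- Off the null set of ties, the first minimizer is `k` exactly when the key of `k` has the least
hash value; injectivity of `key` transfers the uniform law from keys to items. -/
theorem hashLaw_argminHash (hkey : Set.InjOn key D) {k : ℕ} (hk : k ∈ D) :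
    hashLaw.real {h | argminHash D key h = k} = 1 / D.card := by
  have hD : D.Nonempty := ⟨k, hk⟩
  have hF : key k ∈ D.image key := Finset.mem_image_of_mem key hk
  have hcard : (D.image key).card = D.card := Finset.card_image_of_injOn hkey
  rw [← hcard, ← hashLaw_leastEvent hF]
  refine measureReal_congr ?_
  have hties : ∀ᵐ h ∂hashLaw, ∀ l ∈ D, l ≠ k → h (key l) ≠ h (key k) := by
    rw [Finset.eventually_all]
    intro l hl
    by_cases hlk : l = k
    · simp [hlk]
    · have := hashLaw_tie fun he => hlk (hkey hl hk he)
      filter_upwards [measure_eq_zero_iff_ae_notMem.1 this] with h hh _ using hh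
  filter_upwards [hties] with h hh
  refine propext ⟨fun he => ?_, fun he => ?_⟩
  · have he : argminHash D key h = k := he
    intro c hc
    obtain ⟨l, hl, rfl⟩ := Finset.mem_image.1 hc
    exact he ▸ (argminHash_spec hD h).2 l hl
  · have hs := argminHash_spec (key := key) hD h
    by_contra hne
    exact hh _ hs.1 hne (le_antisymm (hs.2 k hk) (he _ (Finset.mem_image_of_mem key hs.1)))

end Argmin

/-! ### Levels as sampling rates -/

theorem levelStep_iterate_spec (n : ℕ) {v : ℝ} (h1 : v ≤ 1) :
    (levelStep^[n] (v, 0)).1 = v * 2 ^ (levelStep^[n] (v, 0)).2 ∧ (levelStep^[n] (v, 0)).1 ≤ 1 ∧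
      ((levelStep^[n] (v, 0)).2 < n → 1 / 2 < (levelStep^[n] (v, 0)).1) := by
  induction n with
  | zero => simpa using h1
  | succ n ih =>
    rw [Function.iterate_succ_apply']
    generalize levelStep^[n] (v, 0) = p at ih ⊢
    obtain ⟨e1, e2, e3⟩ := ih
    rw [levelStep]
    split_ifs with hp
    · refine ⟨?_, by simp only; linarith, fun hlt => ?_⟩
      · simp only [pow_succ, e1]
        ring
      · simp only [Nat.succ_lt_succ_iff] at hlt
        exact absurd hp (not_le.2 (e3 (by simpa using hlt)))
    · exact ⟨e1, e2, fun _ => not_le.1 hp⟩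

/-- After `q` doublings the value is `v * 2 ^ q ≤ 1`, and stopping before `n` means that it exceeds
`1 / 2`. The truncation at `n` is invisible for `l ≤ n`. -/
theorem le_level_iff {n l : ℕ} {v : ℝ} (hl : l ≤ n) (h0 : 0 ≤ v) (h1 : v ≤ 1) :
    l ≤ level n v ↔ v ≤ (1 / 2) ^ l := by
  obtain ⟨e1, e2, e3⟩ := levelStep_iterate_spec n h1
  change l ≤ (levelStep^[n] (v, 0)).2 ↔ _
  generalize levelStep^[n] (v, 0) = p at *
  rw [div_pow, one_pow, le_div_iff₀ (by positivity)]
  constructor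
  · intro h
    refine le_trans ?_ (e1 ▸ e2)
    exact mul_le_mul_of_nonneg_left (pow_le_pow_right₀ one_le_two h) h0
  · intro h
    by_contra! hlt
    have h2 := e3 (by omega)
    have h3 : v * 2 ^ (p.2 + 1) ≤ v * 2 ^ l :=
      mul_le_mul_of_nonneg_left (pow_le_pow_right₀ one_le_two hlt) h0
    rw [pow_succ, ← mul_assoc, ← e1] at h3
    linarith

/-- The number `2⁻ˡ`. -/
noncomputable def halfPow (l : ℕ) : unitInterval :=
  ⟨(1 / 2) ^ l, by positivity, pow_le_one₀ (by norm_num) (by norm_num)⟩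

/-- The least `l` with the first property. At rate `2⁻ˡ` the expected sample of `n` elements is at
most `κ`, and more than `κ / 2` unless everything is sampled. -/
theorem exists_sampling_level {κ : ℕ} (hκ : 0 < κ) (n : ℕ) :
    ∃ l, n ≤ κ * 2 ^ l ∧ (l = 0 ∨ κ * 2 ^ l < 2 * n) := by
  classical
  have hex : ∃ l, n ≤ κ * 2 ^ l :=
    ⟨n, Nat.lt_two_pow_self.le.trans (Nat.le_mul_of_pos_left _ hκ)⟩
  refine ⟨Nat.find hex, Nat.find_spec hex, ?_⟩
  rcases hl : Nat.find hex with - | l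
  · exact Or.inl rfl
  · have := Nat.find_min hex (m := l) (by omega)
    right
    rw [pow_succ, ← mul_assoc]
    omega

theorem half_pow_clog_le {m : ℕ} (hm : 2 ≤ m) : ((1 : ℝ) / 2) ^ Nat.clog 2 m ≤ 1 / m := by
  rw [div_pow, one_pow]
  have h1 : (m : ℝ) ≤ 2 ^ Nat.clog 2 m := by exact_mod_cast Nat.le_pow_clog (by norm_num) m
  have h2 : (0 : ℝ) < m := by positivity
  exact one_div_le_one_div_of_le h2 h1

/-! ### Tail bounds, uniformly over all windows -/

section Bounds

variable {m : ℕ}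

/-- With `K = 128 * a` one has `y ≤ K / 8` and `Kᴷ / K! ≤ exp K ≤ 4ᴷ`, so the quotient is at most
`2⁻ᴷ`. -/
theorem many_bound (hm : 2 ≤ m) {y : ℝ} (h0 : 0 ≤ y) (hy : y ≤ 16 * Nat.clog 2 m) :
    y ^ slotsPerLevel m / (slotsPerLevel m).factorial ≤ (1 / m : ℝ) ^ 8 := by
  set a := Nat.clog 2 m with ha
  have hK : slotsPerLevel m = 128 * a := rfl
  rw [hK]
  have h1 := Real.pow_div_factorial_le_exp (x := ((128 * a : ℕ) : ℝ)) (by positivity) (128 * a)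
  have h2 : y ^ (128 * a) ≤ (((128 * a : ℕ) : ℝ)) ^ (128 * a) * (1 / 8) ^ (128 * a) := by
    rw [← mul_pow]
    refine pow_le_pow_left₀ h0 ?_ _
    push_cast
    linarith
  have h3 : Real.exp ((128 * a : ℕ) : ℝ) ≤ 4 ^ (128 * a) := by
    rw [← mul_one ((128 * a : ℕ) : ℝ), Real.exp_nat_mul]
    refine pow_le_pow_left₀ (Real.exp_pos _).le ?_ _
    linarith [Real.exp_one_lt_d9]
  have hf : (0 : ℝ) < (128 * a).factorial := by positivity
  calc y ^ (128 * a) / (128 * a).factorial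
      ≤ ((((128 * a : ℕ) : ℝ)) ^ (128 * a) * (1 / 8) ^ (128 * a)) / (128 * a).factorial := by
        gcongr
    _ = (((128 * a : ℕ) : ℝ)) ^ (128 * a) / (128 * a).factorial * (1 / 8) ^ (128 * a) := by ring
    _ ≤ 4 ^ (128 * a) * (1 / 8) ^ (128 * a) := by
        gcongr
        exact h1.trans h3
    _ = ((1 / 2) ^ a) ^ 128 := by
        rw [← mul_pow, ← pow_mul, mul_comm a]
        norm_num
    _ ≤ ((1 / 2) ^ a) ^ 8 := pow_le_pow_of_le_one (by positivity)
        (pow_le_one₀ (by norm_num) (by norm_num)) (by norm_num)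
    _ ≤ (1 / m : ℝ) ^ 8 := pow_le_pow_left₀ (by positivity) (half_pow_clog_le hm) _

theorem none_bound (hm : 2 ≤ m) {y : ℝ} (hy : 8 * Nat.clog 2 m ≤ y) :
    Real.exp (-y) ≤ (1 / m : ℝ) ^ 8 := by
  set a := Nat.clog 2 m with ha
  have h1 : Real.exp (-1) ≤ 1 / 2 := by
    rw [Real.exp_neg, ← one_div]
    exact one_div_le_one_div_of_le (by norm_num) (by linarith [Real.exp_one_gt_d9])
  calc Real.exp (-y) ≤ Real.exp ((8 * a : ℕ) * (-1)) := Real.exp_le_exp.2 (by push_cast; linarith)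
    _ = (Real.exp (-1) ^ a) ^ 8 := by rw [Real.exp_nat_mul, ← pow_mul, mul_comm a]
    _ ≤ ((1 / 2) ^ a) ^ 8 := by gcongr
    _ ≤ (1 / m : ℝ) ^ 8 := pow_le_pow_left₀ (by positivity) (half_pow_clog_le hm) _

open Classical in
/-- At the sampling rates `2⁻ˡ`, with `l = lam i j`, none of the sets `D i s` with `s ≤ j` has more
sampled elements than fit in a level, and `D i j` has at least one (unless `l = 0`). -/
def GoodSamples (m : ℕ) (D : ℕ → ℕ → Finset ℕ) (key : ℕ → List ℤ) (lam : ℕ → ℕ → ℕ)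
    (h : HashFun) : Prop :=
  ∀ i ≤ m, ∀ j ≤ m,
    (∀ s ≤ j, ((D i s).filter fun k => h (key k) ≤ halfPow (lam i j)).card ≤ slotsPerLevel m) ∧
    (lam i j ≠ 0 → ∃ k ∈ D i j, h (key k) ≤ halfPow (lam i j))

theorem hashLaw_not_goodSamples_le (hm : 2 ≤ m) {D : ℕ → ℕ → Finset ℕ} {key : ℕ → List ℤ}
    {lam : ℕ → ℕ → ℕ} (hkey : ∀ i, ∀ j ≤ m, Set.InjOn key (D i j))
    (hmono : ∀ i j j', j ≤ j' → j' ≤ m → (D i j).card ≤ (D i j').card)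
    (hlam : ∀ i j, (D i j).card ≤ 16 * Nat.clog 2 m * 2 ^ lam i j ∧
      (lam i j = 0 ∨ 16 * Nat.clog 2 m * 2 ^ lam i j < 2 * (D i j).card)) :
    hashLaw.real {h | ¬ GoodSamples m D key lam h} ≤ 1 / m := by
  classical
  -- The failure is a sample of more than `slotsPerLevel m` elements. The event `A` only asks for at
  -- least that many, as in `hashLaw_many_le`, and counts keys, which is the same by injectivity.
  let A : ℕ → ℕ → ℕ → Set HashFun := fun i j s =>
    {h | slotsPerLevel m ≤ (((D i s).image key).filter fun c => h c ≤ halfPow (lam i j)).card}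
  let B : ℕ → ℕ → Set HashFun := fun i j =>
    {h | lam i j ≠ 0 ∧ ∀ c ∈ (D i j).image key, halfPow (lam i j) < h c}
  have hpow : ∀ l : ℕ, ((halfPow l : ℝ)) * 2 ^ l = 1 := fun l => by
    simp only [halfPow]
    rw [← mul_pow]
    norm_num
  have hA : ∀ i, ∀ j ≤ m, ∀ s ≤ j, hashLaw.real (A i j s) ≤ (1 / m : ℝ) ^ 8 := by
    intro i j hj s hs
    refine (hashLaw_many_le _ _ _).trans (many_bound hm
      (mul_nonneg (Nat.cast_nonneg _) (halfPow _).2.1) ?_)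
    -- The rate is chosen for `D i j`, but by monotonicity it suits every earlier `D i s` as well.
    have h1 : ((D i s).image key).card ≤ 16 * Nat.clog 2 m * 2 ^ lam i j :=
      Finset.card_image_le.trans ((hmono i s j hs hj).trans (hlam i j).1)
    have h2 : (((D i s).image key).card : ℝ) ≤ 16 * Nat.clog 2 m * 2 ^ lam i j := by
      exact_mod_cast h1
    calc _ ≤ 16 * (Nat.clog 2 m : ℝ) * 2 ^ lam i j * (halfPow (lam i j) : ℝ) :=
          mul_le_mul_of_nonneg_right h2 (halfPow _).2.1
      _ = 16 * (Nat.clog 2 m : ℝ) := by rw [mul_assoc _ (2 ^ _), mul_comm (2 ^ _), hpow, mul_one]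
  have hB : ∀ i, ∀ j ≤ m, hashLaw.real (B i j) ≤ (1 / m : ℝ) ^ 8 := by
    intro i j hj
    rcases (hlam i j).2 with h0 | h0
    · have : B i j = ∅ := by
        ext h
        simp [B, h0]
      rw [this, measureReal_empty]
      positivity
    · refine (measureReal_mono (fun h hh => hh.2) (measure_ne_top _ _)).trans
        ((hashLaw_none_le _ _).trans (none_bound hm ?_))
      rw [Finset.card_image_of_injOn (hkey i j hj)]
      have h2 : 16 * (Nat.clog 2 m : ℝ) * 2 ^ lam i j < 2 * (D i j).card := by exact_mod_cast h0
      have h3 := mul_le_mul_of_nonneg_left h2.le (halfPow (lam i j)).2.1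
      have h4 := hpow (lam i j)
      have h5 : (halfPow (lam i j) : ℝ) * (16 * (Nat.clog 2 m : ℝ) * 2 ^ lam i j) =
          16 * (Nat.clog 2 m : ℝ) := by
        rw [mul_comm (16 * _) (2 ^ _), ← mul_assoc, h4, one_mul]
      rw [h5] at h3
      linarith
  have hsub : {h | ¬ GoodSamples m D key lam h} ⊆
      ⋃ i ∈ Finset.range (m + 1), ⋃ j ∈ Finset.range (m + 1),
        ((⋃ s ∈ Finset.range (j + 1), A i j s) ∪ B i j) := by
    intro h hh
    simp only [GoodSamples, Set.mem_ofPred_eq] at hh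
    push Not at hh
    obtain ⟨i, hi, j, hj, hh⟩ := hh
    simp only [Set.mem_iUnion, Finset.mem_range, Set.mem_union]
    refine ⟨i, by omega, j, by omega, ?_⟩
    by_cases hs : ∀ s ≤ j,
        ((D i s).filter fun k => h (key k) ≤ halfPow (lam i j)).card ≤ slotsPerLevel m
    · obtain ⟨h1, h2⟩ := hh hs
      refine Or.inr ⟨h1, fun c hc => ?_⟩
      obtain ⟨k, hk, rfl⟩ := Finset.mem_image.1 hc
      exact h2 k hk
    · push Not at hs
      obtain ⟨s, hs, hcard⟩ := hs
      refine Or.inl ⟨s, by omega, ?_⟩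
      change slotsPerLevel m ≤ _
      rw [Finset.filter_image, Finset.card_image_of_injOn]
      · exact hcard.le
      · exact (hkey i s (by omega)).mono fun k hk => (Finset.mem_filter.1 hk).1
  have hm0 : (2 : ℝ) ≤ m := by exact_mod_cast hm
  have hAB : ∀ i ∈ Finset.range (m + 1), ∀ j ∈ Finset.range (m + 1),
      hashLaw.real ((⋃ s ∈ Finset.range (j + 1), A i j s) ∪ B i j) ≤
        (m + 2) * (1 / m : ℝ) ^ 8 := by
    intro i _ j hj
    have hj : j ≤ m := Nat.lt_succ_iff.1 (Finset.mem_range.1 hj)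
    have hj' : (j : ℝ) ≤ m := by exact_mod_cast hj
    refine (measureReal_union_le _ _).trans ?_
    have h1 : hashLaw.real (⋃ s ∈ Finset.range (j + 1), A i j s) ≤ (j + 1) * (1 / m : ℝ) ^ 8 := by
      refine (measureReal_biUnion_finset_le _ _).trans ((Finset.sum_le_card_nsmul _ _ _
        fun s hs => hA i j hj s (Nat.lt_succ_iff.1 (Finset.mem_range.1 hs))).trans ?_)
      simp
    have h2 := hB i j hj
    have h3 : ((j : ℝ) + 1) * (1 / m : ℝ) ^ 8 ≤ (m + 1) * (1 / m : ℝ) ^ 8 := by gcongr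
    linarith
  have hrow : ∀ i ∈ Finset.range (m + 1), hashLaw.real (⋃ j ∈ Finset.range (m + 1),
      ((⋃ s ∈ Finset.range (j + 1), A i j s) ∪ B i j)) ≤
        (m + 1) * ((m + 2) * (1 / m : ℝ) ^ 8) := by
    intro i hi
    refine (measureReal_biUnion_finset_le _ _).trans ((Finset.sum_le_card_nsmul _ _ _
      fun j hj => hAB i hi j hj).trans ?_)
    simp
  have hall : hashLaw.real {h | ¬ GoodSamples m D key lam h} ≤
      (m + 1) * ((m + 1) * ((m + 2) * (1 / m : ℝ) ^ 8)) := by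
    refine (measureReal_mono hsub (measure_ne_top _ _)).trans
      ((measureReal_biUnion_finset_le _ _).trans ((Finset.sum_le_card_nsmul _ _ _ hrow).trans ?_))
    simp
  refine hall.trans ?_
  -- There are `(m + 1)²` pairs with at most `m + 2` events each, and `m ≥ 2`, so the exponent 8
  -- leaves `1 / m`.
  have h8 : ((m : ℝ) + 1) * ((m + 1) * (m + 2)) ≤ m ^ 7 := by
    have h1 : ((m : ℝ) + 1) ≤ m ^ 2 := by nlinarith
    have h2 : ((m : ℝ) + 2) ≤ m ^ 2 := by nlinarith
    calc ((m : ℝ) + 1) * ((m + 1) * (m + 2)) ≤ m ^ 2 * (m ^ 2 * m ^ 2) := by gcongr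
      _ = m ^ 6 := by ring
      _ ≤ m ^ 7 := pow_le_pow_right₀ (by linarith) (by norm_num)
  calc ((m : ℝ) + 1) * ((m + 1) * ((m + 2) * (1 / m : ℝ) ^ 8))
      = (((m : ℝ) + 1) * ((m + 1) * (m + 2))) * (1 / m : ℝ) ^ 8 := by ring
    _ ≤ m ^ 7 * (1 / m : ℝ) ^ 8 := by gcongr
    _ = 1 / m := by field_simp

end Bounds

/-! ### From the least hash value to a robust sample -/

theorem dist_le_trans_of_sparse {E : Type*} [PseudoMetricSpace E] {α β : ℝ} {S : Set E}
    (hS : IsSparse α β S) (hβ : 2 * α < β) {u v z : E} (hu : u ∈ S) (hz : z ∈ S)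
    (huv : dist u v ≤ α) (hvz : dist v z ≤ α) : dist u z ≤ α :=
  (hS u hu z hz).resolve_right fun h => by linarith [dist_triangle u v z]

/-- The groups are the traces on `W` of the `α`-balls around the representatives. Each contains
exactly one representative, so the sample lies in the group of `k` exactly when the minimizer is
`k`. -/
theorem isRobustSample_argminHash {E : Type*} [PseudoMetricSpace E] [MeasurableSpace E]
    {α β : ℝ} (hα : 0 ≤ α) (hβ : 2 * α < β) {pt : ℕ → E} {m i j : ℕ} (hj : j ≤ m)
    (hsparse : IsSparse α β (pt '' Set.Iio m)) {W : Finset E}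
    (hW : ∀ y, y ∈ W ↔ ∃ k, i ≤ k ∧ k < j ∧ pt k = y) (hne : W.Nonempty) {key : ℕ → List ℤ}
    (hkey : Set.InjOn key (latest (fun k l => dist (pt k) (pt l) ≤ α) i j)) :
    IsRobustSample hashLaw α W fun h =>
      pt (argminHash (latest (fun k l => dist (pt k) (pt l) ≤ α) i j) key h) := by
  classical
  set near : ℕ → ℕ → Prop := fun k l => dist (pt k) (pt l) ≤ α with hnear
  set D := latest near i j with hD
  have hrefl : ∀ k, near k k := fun k => by simp [hnear, hα]
  have hsymm : ∀ k l, near k l → near l k := fun k l h => (dist_comm _ _).trans_le h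
  have hmem : ∀ {k}, k < m → pt k ∈ pt '' Set.Iio m := fun {k} hk => ⟨k, hk, rfl⟩
  have htrans : ∀ k < m, ∀ l < m, ∀ n < m, near k l → near l n → near k n :=
    fun k hk l hl n hn h1 h2 => dist_le_trans_of_sparse hsparse hβ (hmem hk) (hmem hn) h1 h2
  have hDlt : ∀ {k}, k ∈ D → i ≤ k ∧ k < j := fun hk => (mem_latest.1 hk).1
  have hDne : D.Nonempty := by
    obtain ⟨y, hy⟩ := hne
    obtain ⟨k, h1, h2, -⟩ := (hW y).1 hy
    obtain ⟨k', hk', -⟩ := exists_mem_latest hrefl htrans hj h1 h2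
    exact ⟨k', hk'⟩
  let g : ℕ → Finset E := fun k => W.filter fun y => dist y (pt k) ≤ α
  have hgmem : ∀ {k l}, k ∈ D → l ∈ D → (pt k ∈ g l ↔ k = l) := by
    intro k l hk hl
    simp only [g, Finset.mem_filter, hW]
    constructor
    · rintro ⟨-, h⟩
      exact latest_eq_of_near hsymm hk hl h
    · rintro rfl
      exact ⟨⟨k, (hDlt hk).1, (hDlt hk).2, rfl⟩, hrefl k⟩
  have hginj : Set.InjOn g D := fun k hk l hl he =>
    (hgmem hk hl).1 (he ▸ (hgmem hk hk).2 rfl)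
  refine ⟨(measurable_from_top (f := pt)).comp (measurable_argminHash hDne), fun h => ?_, ?_⟩
  · have hs := hDlt (argminHash_spec (key := key) hDne h).1
    exact (hW _).2 ⟨_, hs.1, hs.2, rfl⟩
  refine ⟨Finpartition.ofExistsUnique (D.image g) ?_ ?_ ?_, ⟨?_, ?_⟩, ?_⟩
  · intro G hG
    obtain ⟨k, -, rfl⟩ := Finset.mem_image.1 hG
    exact Finset.filter_subset _ _
  · intro y hy
    obtain ⟨l, h1, h2, rfl⟩ := (hW y).1 hy
    obtain ⟨k, hk, hlk⟩ := exists_mem_latest hrefl htrans hj h1 h2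
    refine ⟨g k, ⟨Finset.mem_image_of_mem g hk, Finset.mem_filter.2 ⟨hy, hlk⟩⟩, ?_⟩
    rintro G ⟨hG, hlG⟩
    obtain ⟨n, hn, rfl⟩ := Finset.mem_image.1 hG
    have hln : near l n := (Finset.mem_filter.1 hlG).2
    have hkm := (hDlt hk).2
    have hnm := (hDlt hn).2
    rw [latest_eq_of_near hsymm hk hn
      (htrans k (by omega) l (by omega) n (by omega) (hsymm _ _ hlk) hln)]
  · intro h0
    obtain ⟨k, hk, h0⟩ := Finset.mem_image.1 h0
    have := (hgmem hk hk).2 rfl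
    rw [h0] at this
    simp at this
  · intro G hG u hu v hv
    obtain ⟨k, hk, rfl⟩ := Finset.mem_image.1 hG
    obtain ⟨huW, hu⟩ := Finset.mem_filter.1 hu
    obtain ⟨hvW, hv⟩ := Finset.mem_filter.1 hv
    obtain ⟨a, -, ha, rfl⟩ := (hW u).1 huW
    obtain ⟨b, -, hb, rfl⟩ := (hW v).1 hvW
    have hkm := (hDlt hk).2
    exact htrans a (by omega) k (by omega) b (by omega) hu (hsymm _ _ hv)
  · intro G hG G' hG' hGG u hu v hv
    obtain ⟨k, hk, rfl⟩ := Finset.mem_image.1 hG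
    obtain ⟨l, hl, rfl⟩ := Finset.mem_image.1 hG'
    obtain ⟨huW, hu⟩ := Finset.mem_filter.1 hu
    obtain ⟨hvW, hv⟩ := Finset.mem_filter.1 hv
    obtain ⟨a, -, ha, rfl⟩ := (hW u).1 huW
    obtain ⟨b, -, hb, rfl⟩ := (hW v).1 hvW
    have hkm := (hDlt hk).2
    have hlm := (hDlt hl).2
    rcases hsparse _ (hmem (show a < m by omega)) _ (hmem (show b < m by omega)) with hab | hab
    · refine absurd ?_ hGG
      rw [latest_eq_of_near hsymm hk hl (htrans k (by omega) a (by omega) l (by omega)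
        (hsymm _ _ hu) (htrans a (by omega) b (by omega) l (by omega) hab hv))]
    · linarith
  · intro G hG
    change G ∈ D.image g at hG
    obtain ⟨k, hk, rfl⟩ := Finset.mem_image.1 hG
    have hset : {h | pt (argminHash D key h) ∈ g k} = {h | argminHash D key h = k} := by
      ext h
      exact hgmem (argminHash_spec hDne h).1 hk
    rw [hset, hashLaw_argminHash hkey hk]
    change _ = 1 / ((D.image g).card : ℝ)
    rw [Finset.card_image_of_injOn hginj]

/-! ### Grid cells separate the groups -/

section Cells

variable {d m : ℕ} {x : Fin m → EuclideanSpace ℝ (Fin d)} {τ : Fin m → ℕ} {α β : ℝ}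

theorem image_pointAt (x : Fin m → EuclideanSpace ℝ (Fin d)) :
    pointAt x '' Set.Iio m = Set.range x := by
  ext y
  constructor
  · rintro ⟨k, hk, rfl⟩
    exact ⟨⟨k, hk⟩, (pointAt_eq x hk).symm⟩
  · rintro ⟨i, rfl⟩
    exact ⟨i, i.2, pointAt_val x i⟩

/-- In one cell each coordinate differs by less than `d * α`, so the squared distance is at most `d
* (d * α)² = d³ * α²`. This puts the distance below `β`, and sparsity brings it down to `α`. -/
theorem near_of_cell_eq (hd : 1 ≤ d) (hα : 0 < α) (hβ : (d : ℝ) ^ (3 / 2 : ℝ) * α < β)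
    (hS : IsSparse α β (Set.range x)) {k l : ℕ} (hk : k < m) (hl : l < m)
    (h : cell d α (itemAt x τ k) = cell d α (itemAt x τ l)) : Near x α k l := by
  have hd0 : (0 : ℝ) < d := by exact_mod_cast hd
  have hdα : 0 < d * α := by positivity
  rw [cell, cell, List.map_inj_left] at h
  have hcoord : ∀ n : Fin d, (pointAt x k n - pointAt x l n) ^ 2 ≤ (d * α) ^ 2 := by
    intro n
    have h1 := Int.abs_sub_lt_one_of_floor_eq_floor (h n (List.mem_range.2 n.2))
    rw [← sub_mul, abs_mul, abs_of_pos (one_div_pos.2 hdα), mul_one_div, div_lt_one hdα,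
      itemAt_coord, itemAt_coord] at h1
    rw [← sq_abs]
    exact pow_le_pow_left₀ (abs_nonneg _) h1.le 2
  have hdist : dist (pointAt x k) (pointAt x l) ≤ (d : ℝ) ^ (3 / 2 : ℝ) * α := by
    rw [EuclideanSpace.dist_eq]
    refine Real.sqrt_le_iff.2 ⟨by positivity, ?_⟩
    have h2 : ((d : ℝ) ^ (3 / 2 : ℝ)) ^ 2 = (d : ℝ) ^ 3 := by
      rw [← Real.rpow_natCast, ← Real.rpow_mul hd0.le, ← Real.rpow_natCast]
      norm_num
    rw [mul_pow, h2]
    calc ∑ n, dist (pointAt x k n) (pointAt x l n) ^ 2 ≤ ∑ _n : Fin d, (d * α) ^ 2 :=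
          Finset.sum_le_sum fun n _ => by
            rw [Real.dist_eq, sq_abs]
            exact hcoord n
      _ = (d : ℝ) ^ 3 * α ^ 2 := by
          simp
          ring
  rw [Near, pointAt_eq x hk, pointAt_eq x hl] at *
  exact (hS _ ⟨_, rfl⟩ _ ⟨_, rfl⟩).resolve_right fun h => by linarith

end Cells

/-! ### Bounds for the resources -/

/-- `clog 2 n ≤ 1 + log n / log 2 ≤ 2 * log n / log 2`, and `2 / log 2 < 3`. -/
theorem clog_le_log {n : ℕ} (hn : 2 ≤ n) : (Nat.clog 2 n : ℝ) ≤ 3 * Real.log n := by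
  have hpos := Nat.clog_pos (b := 2) (by norm_num) hn
  have h1 : 2 ^ (Nat.clog 2 n - 1) < n := Nat.pow_pred_clog_lt_self (by norm_num) hn
  have hn0 : (0 : ℝ) < n := by positivity
  have h2 : ((Nat.clog 2 n - 1 : ℕ) : ℝ) * Real.log 2 ≤ Real.log n := by
    rw [← Real.log_pow]
    exact Real.log_le_log (by positivity) (by exact_mod_cast h1.le)
  rw [Nat.cast_sub hpos, Nat.cast_one] at h2
  have h3 : Real.log 2 ≤ Real.log n := Real.log_le_log (by norm_num) (by exact_mod_cast hn)
  have h4 := Real.log_two_gt_d9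
  have h5 : (1 : ℝ) ≤ Nat.clog 2 n := by exact_mod_cast hpos
  nlinarith

theorem le_resource_bound {d m w N : ℕ} (hm : 2 ≤ m) (hw : 2 ≤ w)
    (hN : N ≤ 10000 * (d * (Nat.clog 2 w * Nat.clog 2 m))) :
    (N : ℝ) ≤ 90000 * (d * Real.log w * Real.log m) := by
  have h1 : (N : ℝ) ≤ 10000 * (d * (Nat.clog 2 w * Nat.clog 2 m)) := by exact_mod_cast hN
  have h2 := mul_le_mul (clog_le_log hw) (clog_le_log hm) (Nat.cast_nonneg _)
    (mul_nonneg (by norm_num) (Real.log_natCast_nonneg w))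
  have h3 := mul_le_mul_of_nonneg_left h2 (Nat.cast_nonneg (α := ℝ) d)
  linarith

section Resources

variable {d m w : ℕ}

theorem resources_le (hd : 1 ≤ d) (hm : 2 ≤ m) (hw : 2 ≤ w) :
    slotAddr d (slotCount m w) ≤ 10000 * (d * (Nat.clog 2 w * Nat.clog 2 m)) ∧
      updateCost d m w ≤ 10000 * (d * (Nat.clog 2 w * Nat.clog 2 m)) ∧
      queryCost d m w ≤ 10000 * (d * (Nat.clog 2 w * Nat.clog 2 m)) := by
  have ha := Nat.clog_pos (b := 2) (by norm_num) hm
  have hb := Nat.clog_pos (b := 2) (by norm_num) hw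
  simp only [slotAddr, updateCost, queryCost, slotCount, slotsPerLevel]
  generalize Nat.clog 2 m = a at *
  generalize Nat.clog 2 w = b at *
  have h1 : a ≤ b * a := Nat.le_mul_of_pos_left a hb
  have h2 : b ≤ b * a := Nat.le_mul_of_pos_right b ha
  have h3 : b * a ≤ d * (b * a) := Nat.le_mul_of_pos_left _ hd
  have h4 : d ≤ d * (b * a) := Nat.le_mul_of_pos_right d (by positivity)
  have h5 : d * a ≤ d * (b * a) := Nat.mul_le_mul_left d h1
  -- Every monomial that occurs is at most `d * (b * a)`; with the monomials as atoms the claims are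
  -- linear.
  refine ⟨?_, ?_, ?_⟩ <;> ring_nf at * <;> omega

end Resources

/-! ### Correctness of the answers and the main theorem -/

section Main

variable {d m w : ℕ} {α β : ℝ} {x : Fin m → EuclideanSpace ℝ (Fin d)} {τ : Fin m → ℕ}

theorem SlotsInv.levelAt_step {s i : ℕ} {h : HashFun} {st : ℕ → ℕ} {M : Mem}
    (hs : slotAddr d (slotCount m w) ≤ s) (hd : 1 ≤ d) (hm : 2 ≤ m) (hw : 1 ≤ w) (hα : 0 < α)
    (hi : i < m) (hM : HoldsState x τ w α i st M)
    (hst : SlotsInv (Near x α) (levelAt h x τ w α) (slotsPerLevel m) (slotCount m w) i st) :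
    ∃ M' st' k, Exec s h (itemAt x τ i) updateProg M M' k ∧ k ≤ updateCost d m w ∧
      HoldsState x τ w α (i + 1) st' M' ∧
      SlotsInv (Near x α) (levelAt h x τ w α) (slotsPerLevel m) (slotCount m w) (i + 1) st' := by
  obtain ⟨M', k, he, hk, st', hstep, hM'⟩ := hM.step (h := h) hs hd hm hw hα hi
  refine ⟨M', st', k, he, hk, hM', hst.step hstep ?_⟩
  rw [slotCount, mul_comm]
  exact Nat.mul_le_mul_left _ (Nat.succ_le_succ (level_le _ _))

/-- The items whose points are the last points of the groups of the window at time `t`. -/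
noncomputable def windowItems (x : Fin m → EuclideanSpace ℝ (Fin d)) (τ : Fin m → ℕ) (w : ℕ) (α : ℝ)
    (t : ℕ) : Finset ℕ :=
  latest (Near x α) (expired τ w t) (arrived τ t)

/-- The list that is hashed for item `i`. -/
noncomputable def keyAt (x : Fin m → EuclideanSpace ℝ (Fin d)) (τ : Fin m → ℕ) (α : ℝ) (i : ℕ) :
    List ℤ :=
  cell d α (itemAt x τ i)

/-- Different lists among the first `m` keys have different hash values. -/
def NoTies (m : ℕ) (key : ℕ → List ℤ) (h : HashFun) : Prop :=
  ∀ k < m, ∀ l < m, key k ≠ key l → h (key k) ≠ h (key l)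

theorem hashLaw_not_noTies (m : ℕ) (key : ℕ → List ℤ) :
    hashLaw.real {h | ¬ NoTies m key h} = 0 := by
  have hnull : hashLaw {h | ¬ NoTies m key h} = 0 := by
    rw [← ae_iff]
    simp only [NoTies, ← Finset.mem_range]
    rw [Finset.eventually_all]
    intro k _
    rw [Finset.eventually_all]
    intro l _
    by_cases hkl : key k = key l
    · simp [hkl]
    · filter_upwards [measure_eq_zero_iff_ae_notMem.1 (hashLaw_tie hkl)] with h hh _ using hh
  rw [measureReal_def, hnull, ENNReal.toReal_zero]

theorem slotAlive_iff (hτ : StrictMono τ) {t : ℕ} {st : ℕ → ℕ} {M : Mem}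
    (hM : HoldsState x τ w α (arrived τ t) st M) {j : ℕ} (hj : j < slotCount m w)
    (hle : st j ≤ arrived τ t) :
    SlotAlive d w t M j ↔ st j ≠ 0 ∧ expired τ w t ≤ st j - 1 := by
  rw [SlotAlive, hM.counter j hj, Nat.cast_pos, Nat.pos_iff_ne_zero]
  refine and_congr_right fun h0 => ?_
  have hm : st j - 1 < m := by
    have := arrived_le τ t
    omega
  rw [hM.item j hj h0 d (Nat.lt_succ_self d), itemAt_time, timeAt_eq τ hm, ← not_lt,
    ← le_iff_lt_expired hτ w ⟨_, hm⟩, not_le]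
  norm_cast

/-- Live slots hold window representatives only, and the representative `k₀` with the least hash
value is among them; hence the minimum over the slots is the minimum over all representatives. -/
theorem output_eq {h : HashFun} (hτ : StrictMono τ) {t : ℕ} {st : ℕ → ℕ}
    {M M' : Mem} (hM : HoldsState x τ w α (arrived τ t) st M)
    (hst : SlotsInv (Near x α) (levelAt h x τ w α) (slotsPerLevel m) (slotCount m w)
      (arrived τ t) st)
    (hM' : ((∀ i < slotCount m w, ¬ SlotAlive d w (queryInput t 0) M i) ∨
        ∃ b < slotCount m w, SlotAlive d w (queryInput t 0) M b ∧ M' 0 = (slotAddr d b : ℕ) ∧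
          ∀ i < slotCount m w, SlotAlive d w (queryInput t 0) M i →
            slotHash h d α M b ≤ slotHash h d α M i) ∧
      ∀ a, 41 + 2 * d ≤ a → M' a = M a)
    (hne : (windowItems x τ w α t).Nonempty)
    (hkey : Set.InjOn (keyAt x τ α) (windowItems x τ w α t))
    {lam : ℕ → ℕ → ℕ} (hlam : lam (expired τ w t) (arrived τ t) ≤ Nat.clog 2 w)
    (hgood : GoodSamples m (latest (Near x α)) (keyAt x τ α) lam h)
    (hties : NoTies m (keyAt x τ α) h) :
    outputPoint d M' = pointAt x (argminHash (windowItems x τ w α t) (keyAt x τ α) h) := by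
  classical
  have hq : queryInput t 0 = t := by simp [queryInput]
  rw [hq] at hM'
  set k₀ := argminHash (windowItems x τ w α t) (keyAt x τ α) h with hk₀
  obtain ⟨hk₀D, hk₀min⟩ := argminHash_spec (key := keyAt x τ α) hne h
  rw [← hk₀] at hk₀D hk₀min
  set l := lam (expired τ w t) (arrived τ t) with hl
  have hmem := mem_latest.1 hk₀D
  have hjm := arrived_le τ t
  obtain ⟨hfew, hsome⟩ := hgood (expired τ w t) (by omega) (arrived τ t) hjm
  have hlev : ∀ k, l ≤ levelAt h x τ w α k ↔ h (keyAt x τ α k) ≤ halfPow l := fun k => by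
    rw [levelAt, le_level_iff hlam (h _).2.1 (h _).2.2]
    rfl
  -- Some representative is sampled at rate `2⁻ˡ`, so the one with the least hash value is sampled
  -- too. For `l = 0` the rate is 1.
  have hk₀l : l ≤ levelAt h x τ w α k₀ := by
    rw [hlev]
    by_cases h0 : l = 0
    · rw [h0]
      exact Subtype.coe_le_coe.1 ((h _).2.2.trans_eq (by simp [halfPow]))
    · obtain ⟨k, hk, hkl⟩ := hsome h0
      exact (hk₀min k hk).trans hkl
  obtain ⟨j₀, hj₀, hstj₀⟩ := hst.exists_slot (i₀ := expired τ w t) (l := l)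
    (fun j hj => by simpa only [hlev] using hfew j hj) hk₀D hk₀l
  have hhash : ∀ j < slotCount m w, st j ≠ 0 → slotHash h d α M j = h (keyAt x τ α (st j - 1)) := by
    intro j hj h0
    rw [slotHash, keyAt]
    congr 2
    refine List.map_congr_left fun k hk => ?_
    have hk : k < d := List.mem_range.1 hk
    simp only [hM.item j hj h0 k (by omega)]
  have halive₀ : SlotAlive d w t M j₀ := by
    rw [slotAlive_iff hτ hM hj₀ (hst.le j₀ hj₀), hstj₀]
    exact ⟨by omega, by simpa using hmem.1.1⟩
  obtain ⟨hM', hMM⟩ := hM'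
  obtain ⟨b, hb, hba, hb0, hbmin⟩ := hM'.resolve_left fun H => H j₀ hj₀ halive₀
  rw [slotAlive_iff hτ hM hb (hst.le b hb)] at hba
  have hble := hst.le b hb
  have hbD : st b - 1 ∈ windowItems x τ w α t :=
    mem_latest.2 ⟨⟨hba.2, by omega⟩, hst.isLatest b hb hba.1⟩
  have hb1 := hbmin j₀ hj₀ halive₀
  rw [hhash b hb hba.1, hhash j₀ hj₀ (by omega), hstj₀, Nat.add_sub_cancel] at hb1
  have hbk : st b - 1 = k₀ := by
    by_contra hne'
    refine hties (st b - 1) (by omega) k₀ (by omega) (fun he => hne' (hkey hbD hk₀D he)) ?_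
    exact le_antisymm (Subtype.coe_le_coe.1 hb1) (hk₀min _ hbD)
  ext n
  have hge := slotAddr_ge d b
  rw [outputPoint, PiLp.toLp_apply, hb0, Nat.floor_natCast, hMM _ (by omega),
    hM.item b hb hba.1 n (by omega), itemAt_coord, hbk]

end Main

theorem mainTheorem7 :
    ∃ (A : SWAlgorithm) (C : ℝ) (c : ℕ),
      ∀ (d m w : ℕ) (α β : ℝ) (x : Fin m → EuclideanSpace ℝ (Fin d)) (τ : Fin m → ℕ),
        1 ≤ d → 2 ≤ m → 2 ≤ w → 0 < α →
        (d : ℝ) ^ (3 / 2 : ℝ) * α < β → 2 * α < β →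
        IsSparse α β (Set.range x) → StrictMono τ →
        ∃ mem ans : HashFun → ℕ → Mem,
          (∀ h : HashFun,
            IsRun A h w α x τ c
              (C * (d * Real.log w * Real.log m)) (C * (d * Real.log w * Real.log m))
              (mem h) (ans h)) ∧
          ∃ (Ω : Type) (_ : MeasurableSpace Ω) (ℙ : MeasureTheory.Measure Ω)
            (h : Ω → HashFun) (u : ℕ → Ω → EuclideanSpace ℝ (Fin d)) (good : Set Ω),
            MeasureTheory.IsProbabilityMeasure ℙ ∧
            MeasureTheory.MeasurePreserving h ℙ hashLaw ∧
            (∀ t : ℕ, (window x τ w t).Nonempty →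
              IsRobustSample ℙ α (window x τ w t) (u t)) ∧
            MeasurableSet good ∧
            1 - 1 / (m : ℝ) ≤ ℙ.real good ∧
            ∀ ω ∈ good, ∀ t : ℕ, (window x τ w t).Nonempty →
              outputPoint d (ans (h ω) t) = u t ω := by
  refine ⟨⟨updateProg, queryProg⟩, 90000, 1, ?_⟩
  intro d m w α β x τ hd hm hw hα hβ hβ' hS hτ
  obtain ⟨hspace, hupd, hqry⟩ := resources_le hd hm hw
  set R : ℝ := 90000 * (d * Real.log w * Real.log m) with hR
  have hs : slotAddr d (slotCount m w) ≤ ⌊R⌋₊ := Nat.le_floor (le_resource_bound hm hw hspace)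
  have hrefl : ∀ k, Near x α k k := fun k => by simp [Near, hα.le]
  have hsymm : ∀ k l, Near x α k l → Near x α l k := fun k l h => (dist_comm _ _).trans_le h
  have hmem : ∀ {k}, k < m → pointAt x k ∈ Set.range x := fun {k} hk =>
    image_pointAt x ▸ ⟨k, hk, rfl⟩
  have htrans : ∀ k < m, ∀ l < m, ∀ n < m, Near x α k l → Near x α l n → Near x α k n :=
    fun k hk l hl n hn h1 h2 => dist_le_trans_of_sparse hS hβ' (hmem hk) (hmem hn) h1 h2
  have hkey : ∀ i, ∀ j ≤ m, Set.InjOn (keyAt x τ α) (latest (Near x α) i j) := by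
    intro i j hj k hk l hl he
    have hk' := (mem_latest.1 hk).1
    have hl' := (mem_latest.1 hl).1
    exact latest_eq_of_near hsymm hk hl (near_of_cell_eq hd hα hβ hS (by omega) (by omega) he)
  have hmono : ∀ i j j', j ≤ j' → j' ≤ m →
      (latest (Near x α) i j).card ≤ (latest (Near x α) i j').card := fun i j j' hjj hj =>
    card_latest_mono hrefl hsymm htrans hjj hj
  have hκ : 0 < 16 * Nat.clog 2 m := by
    have := Nat.clog_pos (b := 2) (by norm_num) hm
    omega
  -- The rates depend on the stream alone and not on the hash function. They occur in the analysis
  -- only.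
  choose lam hlam using fun i j => exists_sampling_level hκ (latest (Near x α) i j).card
  have hlamw : ∀ t, lam (expired τ w t) (arrived τ t) ≤ Nat.clog 2 w := by
    intro t
    have hcard := card_latest_le hτ (Near x α) w t
    rcases (hlam (expired τ w t) (arrived τ t)).2 with h0 | h0
    · omega
    · generalize lam (expired τ w t) (arrived τ t) = l at h0 ⊢
      rcases l with - | l
      · omega
      -- A nonzero rate index `l + 1` satisfies `κ * 2 ^ (l + 1) < 2 * w` with `κ = 16 * clog 2 m ≥
      -- 1`, hence `2 ^ l < w`.
      · refine (Nat.lt_clog_iff_pow_lt (by norm_num)).2 ?_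
        rw [pow_succ] at h0
        have : 2 ^ l ≤ 16 * Nat.clog 2 m * 2 ^ l := Nat.le_mul_of_pos_left _ hκ
        nlinarith
  have hrun : ∀ h : HashFun, ∃ mem ans : ℕ → Mem,
      IsRun ⟨updateProg, queryProg⟩ h w α x τ 1 R R mem ans ∧
      ∀ t, (windowItems x τ w α t).Nonempty →
        GoodSamples m (latest (Near x α)) (keyAt x τ α) lam h →
        NoTies m (keyAt x τ α) h →
        outputPoint d (ans t) =
          pointAt x (argminHash (windowItems x τ w α t) (keyAt x τ α) h) := by
    intro h
    obtain ⟨f, hf0, hfP, hfR⟩ := exists_seq_of_step (X := Mem × (ℕ → ℕ)) (x₀ := (initMem d m w α, 0))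
      (P := fun i p => HoldsState x τ w α i p.2 p.1 ∧
        SlotsInv (Near x α) (levelAt h x τ w α) (slotsPerLevel m) (slotCount m w) i p.2)
      (R := fun i p q => ∃ k, Exec ⌊R⌋₊ h (itemAt x τ i) updateProg p.1 q.1 k ∧
        k ≤ updateCost d m w) (m := m)
      ⟨holdsState_init hd (by omega) (by omega), slotsInv_zero _ _ _ _⟩ (by
        rintro i hi ⟨M, st⟩ ⟨hM, hst⟩
        obtain ⟨M', st', k, he, hk, hM', hst'⟩ :=
          hst.levelAt_step hs hd hm (by omega) hα hi hM
        exact ⟨(M', st'), ⟨k, he, hk⟩, hM', hst'⟩)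
    have hquery := fun t : ℕ =>
      have hM := (hfP (arrived τ t) (arrived_le τ t)).1
      queryProg_runs (h := h) (inp := queryInput t) hs hM.r0 hM.r1 hM.r2 hM.r3
    choose ans k he hk hans using hquery
    refine ⟨fun i => (f i).1, ans, ⟨by rw [hf0], fun i => ?_, fun t => ?_, fun i hi a => ?_⟩,
      fun t hne hgood hties => ?_⟩
    · obtain ⟨k, he, hk⟩ := hfR i i.2
      refine ⟨k, (Nat.cast_le.2 hk).trans (le_resource_bound hm hw hupd), ?_⟩
      rw [itemAt, pointAt_val, timeAt_val] at he
      exact he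
    · exact ⟨k t, (Nat.cast_le.2 (hk t)).trans (le_resource_bound hm hw hqry), he t⟩
    · exact (hfP i hi).1.word a
    · obtain ⟨hM, hst⟩ := hfP (arrived τ t) (arrived_le τ t)
      exact output_eq hτ hM hst (hans t) hne (hkey _ _ (arrived_le τ t)) (hlamw t) hgood hties
  choose mem ans hrun hout using hrun
  -- The samples live on the space of hash functions itself. The good set is the complement of a
  -- measurable hull of the bad one, which has the same outer measure, so that measurability of the
  -- bad event is not needed.
  refine ⟨mem, ans, hrun, HashFun, inferInstance, hashLaw, id,
    fun t h => pointAt x (argminHash (windowItems x τ w α t) (keyAt x τ α) h),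
    (toMeasurable hashLaw {h | ¬ (GoodSamples m (latest (Near x α)) (keyAt x τ α) lam h ∧
      NoTies m (keyAt x τ α) h)})ᶜ, inferInstance, MeasurePreserving.id _, ?_,
    (measurableSet_toMeasurable _ _).compl, ?_, ?_⟩
  · intro t hne
    refine isRobustSample_argminHash hα.le hβ' (arrived_le τ t) ?_ (fun y => mem_window_iff hτ) hne
      (hkey _ _ (arrived_le τ t))
    rw [image_pointAt]
    exact hS
  · rw [measureReal_compl (measurableSet_toMeasurable _ _), probReal_univ, measureReal_def,
      measure_toMeasurable, ← measureReal_def]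
    have hle := hashLaw_not_goodSamples_le hm hkey hmono hlam
    have hsub : hashLaw.real {h | ¬ (GoodSamples m (latest (Near x α)) (keyAt x τ α) lam h ∧
        NoTies m (keyAt x τ α) h)} ≤
        hashLaw.real ({h | ¬ GoodSamples m (latest (Near x α)) (keyAt x τ α) lam h} ∪
          {h | ¬ NoTies m (keyAt x τ α) h}) :=
      measureReal_mono (fun h hh => not_and_or.1 hh) (measure_ne_top _ _)
    have hunion := measureReal_union_le (μ := hashLaw)
      {h | ¬ GoodSamples m (latest (Near x α)) (keyAt x τ α) lam h}
      {h | ¬ NoTies m (keyAt x τ α) h}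
    rw [hashLaw_not_noTies] at hunion
    linarith
  · intro h hh t hne
    have hgood : GoodSamples m (latest (Near x α)) (keyAt x τ α) lam h ∧
        NoTies m (keyAt x τ α) h :=
      not_not.1 fun H => hh (subset_toMeasurable _ _ H)
    refine hout h t ?_ hgood.1 hgood.2
    obtain ⟨y, hy⟩ := hne
    obtain ⟨k, h1, h2, -⟩ := (mem_window_iff hτ).1 hy
    obtain ⟨k', hk', -⟩ := exists_mem_latest hrefl htrans (arrived_le τ t) h1 h2
    exact ⟨k', hk'⟩
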